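/- Let $\vec\sigma=(\sigma_x,\sigma_y,\sigma_z)$ be the Pauli matrices and let $\mathcal E$ be the set of qubit effects $E_{\hat n}=\frac14(\mathbf 1+\hat n\cdot\vec\sigma)$, $\hat n\in S^2$. A tetrahedral measurement is a family $E_{\hat n_1},\dots,E_{\hat n_4}$ whose unit vectors point to the vertices of a regular tetrahedron centred at the origin, i.e. $\hat n_i\cdot\hat n_j=-\frac13$ for $i\ne j$ (equivalently, the effects form a symmetric informationally complete POVM). A frame function is a function $f:\mathcal E\to[0,1]$ with $\sum_{j=1}^4 f(E_{\hat n_j})=1$ for every tetrahedral measurement. Put $F(\hat n)=f(E_{\hat n})$. Let $P_l$ be the Legendre polynomials, $P_l^m(x)=(-1)^m(1-x^2)^{m/2}\frac{d^m}{dx^m}P_l(x)$ for $m\ge 0$, and let $Y_{lm}(\theta,\phi)=\sqrt{\frac{2l+1}{4\pi}\frac{(l-m)!}{(l+m)!}}\,P_l^m(\cos\theta)e^{im\phi}$ for $0\le m\le l$, $Y_{l,-m}=(-1)^m\overline{Y_{lm}}$, be the spherical harmonics. For continuous $F$ let $c_{lm}=\int_{S^2}F\,\overline{Y_{lm}}\,d\Omega$,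 and say that $F$ contains the $l$th harmonic if $c_{lm}\neq0$ for some $m$ with $|m|\le l$. The harmonic $l$ is allowed if it is contained in $F$ for some frame function with $F$ continuous. Then: 1. The allowed harmonics are exactly $l=0,1,2,5$. 2. A function $f:\mathcal E\to\mathbb R$ with $F$ continuous is a frame function if and only if $F\ge 0$, $c_{00}=\sqrt{4\pi}/4$ and $$F(\hat n)=\sum_{l\in\{0,1,2,5\}}\ \sum_{m=-l}^{l}c_{lm}Y_{lm}(\hat n)\qquad\text{for all }\hat n\in S^2.$$ 3. For $l=2$ and for $l=5$ there is a frame function with $F$ continuous that contains exactly the harmonics $0$ and $l$, and that is not of the form $f(E)=\operatorname{tr}(WE)$ for any density operator $W$. So the quantum probability rule is not forced. 4. If $\alpha\in\mathbb R$ and $e^{i\alpha}=-\frac1{\sqrt7}+i\sqrt{\frac67}$, then for integers $l\ge0$ $$1+\frac{(-1)^l+2\cdot7^{l/2}\cos l\alpha}{3^l}=0\iff l\in\{1,2,5\}.$$ 5. $P_5(-\frac13)=-\frac13$ and $P_5^3(-\frac13)=0$. -/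

import Mathlib

open scoped Nat ComplexOrder

noncomputable section

namespace Tetrahedral

/-- Euclidean three-space; coordinates `0, 1, 2` are `x, y, z`. -/
abbrev E3 : Type := EuclideanSpace ℝ (Fin 3)

/-- The unit sphere of directions (the Bloch sphere). -/
abbrev S2 : Type := Metric.sphere (0 : E3) 1

/-- Operators on the state space of a qubit. -/
abbrev QubitOp : Type := Matrix (Fin 2) (Fin 2) ℂ

def pauliX : QubitOp := !![0, 1; 1, 0]

def pauliY : QubitOp := !![0, -Complex.I; Complex.I, 0]

def pauliZ : QubitOp := !![1, 0; 0, -1]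

/-- The operator `(1/4) (1 + n · σ)`. -/
def blochOp (n : E3) : QubitOp :=
  (1 / 4 : ℂ) • (1 + (n 0 : ℂ) • pauliX + (n 1 : ℂ) • pauliY + (n 2 : ℂ) • pauliZ)

/-- The effects `(1/4) (1 + n · σ)`, with `n` any unit vector. -/
abbrev Effect : Type := {E : QubitOp // ∃ n : S2, E = blochOp n}

/-- The effect with direction `n`. -/
def effect (n : S2) : Effect := ⟨blochOp n, n, rfl⟩

/-- The four unit vectors point to the vertices of a regular tetrahedron centred at the origin. -/
def IsTetrahedron (n : Fin 4 → S2) : Prop :=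
  ∀ i j, i ≠ j → inner ℝ (n i : E3) (n j : E3) = -1 / 3

/-- A frame function on the tetrahedral measurements: values in `[0, 1]`, with sum `1` over the
outcomes of every tetrahedral measurement. -/
structure IsFrameFunction (f : Effect → ℝ) : Prop where
  mem_unit : ∀ E, f E ∈ Set.Icc (0 : ℝ) 1
  sum_eq_one : ∀ n : Fin 4 → S2, IsTetrahedron n → ∑ j, f (effect (n j)) = 1

/-- The function `F(n) = f((1/4) (1 + n · σ))` on the unit sphere. -/
def onSphere (f : Effect → ℝ) (n : S2) : ℝ := f (effect n)

/-- `W` is a density operator. -/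
def IsDensity (W : QubitOp) : Prop := W.PosSemidef ∧ W.trace = 1

/-- `f` obeys the quantum probability rule `f(E) = tr (W E)` for some density operator `W`. -/
def IsQuantum (f : Effect → ℝ) : Prop :=
  ∃ W, IsDensity W ∧ ∀ E : Effect, (f E : ℂ) = (W * (E : QubitOp)).trace

/-- The Legendre polynomial `P_l`, by the formula of Rodrigues. -/
def legendre (l : ℕ) : Polynomial ℝ :=
  Polynomial.C (1 / (2 ^ l * (l ! : ℝ))) *
    Polynomial.derivative^[l] ((Polynomial.X ^ 2 - 1) ^ l)

/-- The associated Legendre function `P_l^m`, for `0 ≤ m`, with the phase `(-1)^m`. -/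
def assocLegendre (l m : ℕ) (x : ℝ) : ℝ :=
  (-1) ^ m * Real.sqrt (1 - x ^ 2) ^ m * (Polynomial.derivative^[m] (legendre l)).eval x

/-- The normalization `√((2l+1)/(4π) · (l-m)!/(l+m)!)`, for `0 ≤ m ≤ l`. -/
def normConst (l m : ℕ) : ℝ :=
  Real.sqrt ((2 * l + 1) / (4 * Real.pi) * (((l - m)! : ℝ) / ((l + m)! : ℝ)))

/-- The spherical harmonic `Y_{lm}` for `0 ≤ m ≤ l`, in the form `h_{lm}(n_z) (n_x + i n_y)^m`. -/
def sphHarmNat (l m : ℕ) (n : S2) : ℂ :=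
  ((normConst l m * ((-1) ^ m * (Polynomial.derivative^[m] (legendre l)).eval (n.1 2)) : ℝ) : ℂ) *
    ((n.1 0 : ℂ) + (n.1 1 : ℂ) * Complex.I) ^ m

/-- The spherical harmonic `Y_{lm}` for `-l ≤ m ≤ l`, with `Y_{l,-m} = (-1)^m conj Y_{lm}`. -/
def sphHarm (l : ℕ) (m : ℤ) (n : S2) : ℂ :=
  if 0 ≤ m then sphHarmNat l m.natAbs n
  else (-1) ^ m.natAbs * (starRingEnd ℂ) (sphHarmNat l m.natAbs n)

/-- The familiar form `√((2l+1)/(4π) · (l-m)!/(l+m)!) P_l^m(cos θ) e^{i m p}` of `Y_{lm}`, with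
the azimuth `p`. -/
theorem sphHarm_angles (l m : ℕ) (n : S2) (θ p : ℝ) (hθ : θ ∈ Set.Icc 0 Real.pi)
    (hx : n.1 0 = Real.sin θ * Real.cos p) (hy : n.1 1 = Real.sin θ * Real.sin p)
    (hz : n.1 2 = Real.cos θ) :
    sphHarm l m n =
      ((normConst l m * assocLegendre l m (Real.cos θ) : ℝ) : ℂ) *
        Complex.exp (m * p * Complex.I) := by
  have hs : Real.sqrt (1 - Real.cos θ ^ 2) = Real.sin θ := by
    rw [← Real.sin_sq, Real.sqrt_sq (Real.sin_nonneg_of_mem_Icc hθ)]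
  have he : Complex.exp (m * p * Complex.I) =
      (Complex.cos p + Complex.sin p * Complex.I) ^ m := by
    rw [← Complex.exp_mul_I, ← Complex.exp_nat_mul]
    ring_nf
  have hxy : ((n.1 0 : ℂ) + (n.1 1 : ℂ) * Complex.I) =
      (Real.sin θ : ℂ) * (Complex.cos p + Complex.sin p * Complex.I) := by
    rw [hx, hy]
    push_cast
    ring
  rw [he]
  simp only [sphHarm, sphHarmNat, assocLegendre, hs, hxy, hz, mul_pow, Int.natCast_nonneg, if_true,
    Int.natAbs_natCast]
  push_cast
  ring

/-- The coefficient `c_{lm} = ∫ F conj(Y_{lm}) dΩ` of the harmonic `Y_{lm}` in the expansion of `F`;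
`dΩ` is the surface measure of the unit sphere, of total mass `4π`. -/
def coeff (F : S2 → ℝ) (l : ℕ) (m : ℤ) : ℂ :=
  ∫ n, (F n : ℂ) * (starRingEnd ℂ) (sphHarm l m n)
    ∂((MeasureTheory.volume : MeasureTheory.Measure E3).toSphere)

/-- The function `F` contains the `l`th harmonic. -/
def HasHarmonic (F : S2 → ℝ) (l : ℕ) : Prop :=
  ∃ m : ℤ, |m| ≤ (l : ℤ) ∧ coeff F l m ≠ 0

/-- The `l`th harmonic is allowed: it occurs in a frame function that is continuous on the
sphere. -/
def Allowed (l : ℕ) : Prop :=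
  ∃ f, IsFrameFunction f ∧ Continuous (onSphere f) ∧ HasHarmonic (onSphere f) l

/-- Four directions form a regular tetrahedron exactly when their effects form a symmetric
informationally complete POVM: they sum to `1` and have equal pairwise inner products. -/
theorem isTetrahedron_iff_sic (n : Fin 4 → S2) :
    IsTetrahedron n ↔
      (∑ j, (effect (n j) : QubitOp) = 1) ∧
        ∃ c : ℂ, ∀ i j, i ≠ j →
          ((effect (n i) : QubitOp) * (effect (n j) : QubitOp)).trace = c := by
  have htr : ∀ u v : E3, (blochOp u * blochOp v).trace =
      (((1 + inner ℝ u v) / 8 : ℝ) : ℂ) := by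
    intro u v
    simp [blochOp, pauliX, pauliY, pauliZ, Matrix.trace_fin_two, Matrix.mul_apply,
      Fin.sum_univ_two, PiLp.inner_apply, Fin.sum_univ_three]
    ring_nf
    simp [Complex.I_sq]
    ring
  have hnorm : ∀ i, inner ℝ (n i : E3) (n i : E3) = 1 := by
    intro i
    rw [real_inner_self_eq_norm_sq, norm_eq_of_mem_sphere]
    norm_num
  have hsum : (∑ j, (effect (n j) : QubitOp) = 1) ↔ ∑ j, (n j : E3) = 0 := by
    simp only [effect, blochOp, Fin.sum_univ_four]
    constructor
    · intro h
      have h00 := congrFun (congrFun h 0) 0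
      have h01 := congrFun (congrFun h 0) 1
      simp [pauliX, pauliY, pauliZ] at h00 h01
      have a := congrArg Complex.re h00
      have b := congrArg Complex.re h01
      have c := congrArg Complex.im h01
      simp at a b c
      ext k
      fin_cases k <;> simp <;> linarith
    · intro h
      have h0 : ∀ k : Fin 3, ((n 0).1 k : ℂ) + (n 1).1 k + (n 2).1 k + (n 3).1 k = 0 := by
        intro k
        have := congrArg (fun v : E3 => v k) h
        simp at this
        exact_mod_cast this
      ext i j
      fin_cases i <;> fin_cases j <;> simp [pauliX, pauliY, pauliZ]
      · linear_combination (1 / 4) * h0 2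
      · linear_combination (1 / 4) * h0 0 - (Complex.I / 4) * h0 1
      · linear_combination (1 / 4) * h0 0 + (Complex.I / 4) * h0 1
      · linear_combination -(1 / 4) * h0 2
  rw [hsum]
  simp only [effect, htr]
  constructor
  · intro h
    refine ⟨?_, ((1 / 12 : ℝ) : ℂ), ?_⟩
    · rw [← inner_self_eq_zero (𝕜 := ℝ)]
      simp only [Fin.sum_univ_four, inner_add_left, inner_add_right, hnorm]
      rw [h 0 1 (by decide), h 0 2 (by decide), h 0 3 (by decide), h 1 0 (by decide),
        h 1 2 (by decide), h 1 3 (by decide), h 2 0 (by decide), h 2 1 (by decide),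
        h 2 3 (by decide), h 3 0 (by decide), h 3 1 (by decide), h 3 2 (by decide)]
      norm_num
    · intro i j hij
      rw [h i j hij]
      norm_num
  · rintro ⟨h, c, hc⟩
    have hd : ∀ i j, i ≠ j → inner ℝ (n i : E3) (n j : E3) = 8 * c.re - 1 := by
      intro i j hij
      have := congrArg Complex.re (hc i j hij)
      rw [Complex.ofReal_re] at this
      linarith
    have hz : inner ℝ (n 0 : E3) (∑ j, (n j : E3)) = 0 := by rw [h, inner_zero_right]
    simp only [Fin.sum_univ_four, inner_add_right, hnorm] at hz
    rw [hd 0 1 (by decide), hd 0 2 (by decide), hd 0 3 (by decide)] at hz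
    intro i j hij
    rw [hd i j hij]
    linarith

end Tetrahedral

end

noncomputable section

namespace Tetrahedral

/-! For a complex vector a = a₁ + i a₂ write a·n for the bilinear product. If a is isotropic (a·a =
0), then (a·n)^l is a spherical harmonic of degree l, and each Y_{lm} is a combination of such
powers (`exists_sphHarmNat_eq_sum`). So only these powers have to be tested against tetrahedra.

Exclusion of degrees. Averaging over the orthogonal group gives, for isotropic a and b and a unit
vector v, ∫ h(gv) (a·gb)^l dg = λ_l (b·v)^l ∫ h(gv) (a·gv)^l dg with λ_l ≠ 0
(`integral_rot_cdot_pow`). Put h = F and sum over the vertices v_j of a tetrahedron. Since ∑ F(g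
v_j) = 1, the left side becomes ∫ (a·gb)^l dg, which is 0 for l > 0. Hence ∫ F (a·n)^l = 0 unless ∑
(b·v_j)^l = 0. For b = (1, i, 0) and a vertex on the x axis this sum is (3^l + (-1)^l + 2 Re (-1 +
i√6)^l) / 3^l. As |-1 + i√6| = √7 < 3, it is positive for l ≥ 6, and among all l it vanishes only at
1, 2, 5.

Admission of degrees. Let s_j = a·n_j. The tight frame relations of a tetrahedron and a·a = 0 give ∑
s_j = ∑ s_j² = 0. For four numbers with sum 0, Newton's identities make ∑ s_j⁵ a multiple of ∑ s_j²,
so degree 5 passes as well (`tetrahedral_sum_cdot_pow`).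

Expansion. The Y_{lm} are orthonormal, and a continuous function orthogonal to all of them is 0
(Stone-Weierstrass). A continuous frame function has only finitely many nonzero coefficients, so it
equals its expansion with no question of convergence. The examples 1/4 + P_l(n_z)/100 realise the
degrees, and for l = 2, 5 they are not affine in n, as the quantum rule would require. -/

open MeasureTheory

/-! ### Isometry invariance of the surface measure -/

/-- The surface measure of the unit sphere. -/
abbrev sphereMeasure : Measure S2 := (volume : Measure E3).toSphere

/-- A linear isometry acts on the unit sphere. -/
def isoAct (e : E3 ≃ₗᵢ[ℝ] E3) (n : S2) : S2 :=
  ⟨e n.1, by simp [norm_eq_of_mem_sphere n]⟩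

@[simp] lemma isoAct_coe (e : E3 ≃ₗᵢ[ℝ] E3) (n : S2) : (isoAct e n : E3) = e n.1 := rfl

lemma continuous_isoAct (e : E3 ≃ₗᵢ[ℝ] E3) : Continuous (isoAct e) := by
  unfold isoAct; fun_prop

/-- The surface measure of a set is a multiple of the volume of the cone over it, and a linear
isometry carries cones to cones and preserves volume. -/
lemma measurePreserving_isoAct (e : E3 ≃ₗᵢ[ℝ] E3) :
    MeasurePreserving (isoAct e) sphereMeasure sphereMeasure := by
  refine ⟨(continuous_isoAct e).measurable, Measure.ext fun s hs => ?_⟩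
  rw [Measure.map_apply (continuous_isoAct e).measurable hs,
    Measure.toSphere_apply' _ ((continuous_isoAct e).measurable hs), Measure.toSphere_apply' _ hs]
  congr 1
  have he : MeasurePreserving e.toMeasurableEquiv (volume : Measure E3) volume :=
    e.measurePreserving
  conv_rhs => rw [← he.measure_preimage_equiv]
  congr 1
  ext x
  simp only [Set.mem_smul, Set.mem_image, Set.mem_preimage]
  constructor
  · rintro ⟨r, hr, _, ⟨n, hn, rfl⟩, rfl⟩
    exact ⟨r, hr, _, ⟨_, hn, rfl⟩, (e.map_smul r n.1).symm⟩
  · rintro ⟨r, hr, _, ⟨n, hn, rfl⟩, hx⟩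
    refine ⟨r, hr, e.symm n, ⟨isoAct e.symm n, ?_, rfl⟩, ?_⟩
    · have : isoAct e (isoAct e.symm n) = n := Subtype.ext (by simp)
      rwa [this]
    · apply e.injective
      simpa using hx

lemma integral_isoAct {V : Type*} [NormedAddCommGroup V] [NormedSpace ℝ V] (e : E3 ≃ₗᵢ[ℝ] E3)
    (h : S2 → V) (hh : Continuous h) :
    ∫ n, h (isoAct e n) ∂sphereMeasure = ∫ n, h n ∂sphereMeasure := by
  conv_rhs => rw [← (measurePreserving_isoAct e).map_eq]
  rw [integral_map (continuous_isoAct e).measurable.aemeasurable hh.aestronglyMeasurable]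

lemma sphereMeasure_univ : sphereMeasure.real Set.univ = 4 * Real.pi := by
  rw [Measure.toSphere_real_apply_univ, measureReal_def, EuclideanSpace.volume_ball_fin_three]
  have : (0 : ℝ) ≤ Real.pi * 4 / 3 := by positivity
  simp [ENNReal.toReal_ofReal this]
  ring

lemma continuous_integrable {V : Type*} [NormedAddCommGroup V] {h : S2 → V} (hh : Continuous h) :
    Integrable h sphereMeasure :=
  hh.integrable_of_hasCompactSupport (HasCompactSupport.of_compactSpace h)

/-! ### Averaging over the orthogonal group -/

/-- The orthogonal group of Euclidean three-space. -/
abbrev Rot : Type := unitary (E3 →L[ℝ] E3)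

/-- The isometry underlying an element of the orthogonal group. -/
abbrev Rot.iso (g : Rot) : E3 ≃ₗᵢ[ℝ] E3 := Unitary.linearIsometryEquiv g

instance : MeasurableSpace Rot := borel Rot
instance : BorelSpace Rot := ⟨rfl⟩

instance : ContinuousStar (E3 →L[ℝ] E3) :=
  ⟨(ContinuousLinearMap.adjoint (𝕜 := ℝ) (E := E3) (F := E3)).continuous⟩

instance : CompactSpace Rot := by
  refine isCompact_iff_compactSpace.1 (?_ : IsCompact (unitary (E3 →L[ℝ] E3) : Set (E3 →L[ℝ] E3)))
  have : ProperSpace (E3 →L[ℝ] E3) := FiniteDimensional.proper_real _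
  refine Metric.isCompact_of_isClosed_isBounded (isClosed_unitary) ?_
  refine (Metric.isBounded_closedBall (x := (0 : E3 →L[ℝ] E3)) (r := 1)).subset fun g hg => ?_
  rw [mem_closedBall_zero_iff]
  exact ContinuousLinearMap.opNorm_le_bound _ zero_le_one fun x => by
    rw [one_mul]; exact (Unitary.norm_map (⟨g, hg⟩ : Rot) x).le

/-- Right invariance is what the averages need, because isometries that move or fix a base point v
act on g from the right in g v. Inversion turns the left invariant Haar measure into a right
invariant one. -/
lemma exists_rot_measure :
    ∃ ν : Measure Rot, IsProbabilityMeasure ν ∧ ν.IsMulRightInvariant := by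
  refine ⟨(Measure.haarMeasure (⊤ : TopologicalSpace.PositiveCompacts Rot)).inv, ⟨?_⟩, inferInstance⟩
  rw [Measure.inv_apply]
  simpa using Measure.haarMeasure_self (K₀ := (⊤ : TopologicalSpace.PositiveCompacts Rot))

/-- The invariant probability measure on the orthogonal group. -/
def rotMeasure : Measure Rot := exists_rot_measure.choose

instance : IsProbabilityMeasure rotMeasure := exists_rot_measure.choose_spec.1
instance : rotMeasure.IsMulRightInvariant := exists_rot_measure.choose_spec.2

lemma integral_rot_mul_right (h : Rot → ℂ) (k : E3 ≃ₗᵢ[ℝ] E3) :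
    ∫ g : Rot, h (g * Unitary.linearIsometryEquiv.symm k) ∂rotMeasure = ∫ g, h g ∂rotMeasure :=
  integral_mul_right_eq_self h _

lemma iso_mul_symm (g : Rot) (k : E3 ≃ₗᵢ[ℝ] E3) (x : E3) :
    (g * Unitary.linearIsometryEquiv.symm k).iso x = g.iso (k x) := rfl

lemma continuous_iso_apply : Continuous fun p : Rot × E3 => p.1.iso p.2 := by
  have : (fun p : Rot × E3 => p.1.iso p.2) = fun p : Rot × E3 => (p.1 : E3 →L[ℝ] E3) p.2 := rfl
  rw [this]
  fun_prop

@[fun_prop]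
lemma continuous_iso_apply_const (x : E3) : Continuous fun g : Rot => g.iso x :=
  continuous_iso_apply.comp (by fun_prop : Continuous fun g : Rot => (g, x))

lemma continuous_isoAct_rot : Continuous fun p : Rot × S2 => isoAct p.1.iso p.2 := by
  refine Continuous.subtype_mk ?_ _
  exact continuous_iso_apply.comp (by fun_prop : Continuous fun p : Rot × S2 => (p.1, (p.2 : E3)))

@[fun_prop]
lemma continuous_isoAct_rot_const (n : S2) : Continuous fun g : Rot => isoAct g.iso n :=
  continuous_isoAct_rot.comp (by fun_prop : Continuous fun g : Rot => (g, n))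

/-- The full orthogonal group makes this easy: the reflection in the plane orthogonal to n - v
exchanges n and v. -/
lemma exists_isoAct_eq (n v : S2) : ∃ e : E3 ≃ₗᵢ[ℝ] E3, isoAct e n = v := by
  refine ⟨Submodule.reflection (Submodule.span ℝ {(n : E3) - v})ᗮ, Subtype.ext ?_⟩
  exact Submodule.reflection_sub (by simp [norm_eq_of_mem_sphere])

lemma continuous_integrable_rot {h : Rot → ℂ} (hh : Continuous h) : Integrable h rotMeasure :=
  hh.integrable_of_hasCompactSupport (HasCompactSupport.of_compactSpace h)

/-- The average over the orthogonal group of a function of the image of a point is the average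
over the sphere. -/
lemma integral_rot_isoAct (h : S2 → ℂ) (hh : Continuous h) (n : S2) :
    4 * Real.pi * ∫ g : Rot, h (isoAct g.iso n) ∂rotMeasure = ∫ n, h n ∂sphereMeasure := by
  -- By transitivity and right invariance the group average does not depend on the base point.
  -- Fubini then compares it with the integral over base points, which does not depend on g.
  have h1 : ∀ v : S2, ∫ g : Rot, h (isoAct g.iso v) ∂rotMeasure =
      ∫ g : Rot, h (isoAct g.iso n) ∂rotMeasure := by
    intro v
    obtain ⟨e, rfl⟩ := exists_isoAct_eq n v
    rw [← integral_rot_mul_right (fun g => h (isoAct g.iso n)) e]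
    rfl
  have h2 := integral_integral_swap_of_hasCompactSupport (μ := rotMeasure) (ν := sphereMeasure)
    (f := fun (g : Rot) (v : S2) => h (isoAct g.iso v)) (hh.comp continuous_isoAct_rot)
    (HasCompactSupport.of_compactSpace _)
  simp only [h1, integral_isoAct _ h hh, integral_const, sphereMeasure_univ, probReal_univ] at h2
  rw [one_smul] at h2
  rw [h2]
  simp


/-! ### Powers of isotropic linear forms and their averages -/

lemma sum_pow_root_of_unity {N : ℕ} (hN : 0 < N) {ζ : ℂ} (hζ : IsPrimitiveRoot ζ N) {i m : ℕ}
    (him : i ≤ m) (hm : m < N) :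
    ∑ j ∈ Finset.range N, (ζ ^ j) ^ i * ((ζ ^ j)⁻¹) ^ (m - i) = if 2 * i = m then (N : ℂ) else 0 := by
  have hz : ζ ≠ 0 := hζ.ne_zero hN.ne'
  have h1 : ∀ j, (ζ ^ j) ^ i * ((ζ ^ j)⁻¹) ^ (m - i) = (ζ ^ (2 * i - m : ℤ)) ^ j := by
    intro j
    rw [← zpow_natCast, ← zpow_natCast, ← zpow_natCast, ← zpow_natCast, inv_zpow', ← zpow_mul,
      ← zpow_mul, ← zpow_mul, ← zpow_add₀ hz]
    congr 1
    push_cast [him]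
    ring
  simp only [h1]
  split_ifs with h
  · have : (2 * i - m : ℤ) = 0 := by omega
    simp [this]
  -- The exponent is nonzero and |2i - m| ≤ m < N, so N cannot divide it.
  · have hne : ζ ^ (2 * i - m : ℤ) ≠ 1 := by
      rw [Ne, hζ.zpow_eq_one_iff_dvd]
      rintro ⟨c, hc⟩
      have : c = 0 := by
        by_contra hc0
        have : |(N : ℤ) * c| < N := by rw [← hc, abs_lt]; omega
        rw [abs_mul, Nat.abs_cast] at this
        have := Int.one_le_abs hc0
        nlinarith
      subst this
      omega
    rw [geom_sum_eq hne, ← zpow_natCast, ← zpow_mul, mul_comm, zpow_mul, zpow_natCast,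
      hζ.pow_eq_one]
    simp

/-- The constant term of the Laurent polynomial `(A + B T + C T⁻¹) ^ l`, with `P = B C`. -/
def laurentConst (l : ℕ) (A P : ℂ) : ℂ :=
  ∑ m ∈ Finset.range (l + 1), ∑ i ∈ Finset.range (m + 1),
    if 2 * i = m then A ^ (l - m) * l.choose m * (P ^ i * m.choose i) else 0

lemma sum_laurent_pow {N l : ℕ} (hl : l < N) {ζ : ℂ} (hζ : IsPrimitiveRoot ζ N) (A B C : ℂ) :
    ∑ j ∈ Finset.range N, (A + (B * ζ ^ j + C * (ζ ^ j)⁻¹)) ^ l = N * laurentConst l A (B * C) := by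
  have hN : 0 < N := by omega
  simp only [add_comm A, add_pow, laurentConst, Finset.mul_sum]
  rw [Finset.sum_comm]
  refine Finset.sum_congr rfl fun m hm => ?_
  simp only [Finset.sum_mul]
  rw [Finset.sum_comm]
  refine Finset.sum_congr rfl fun i hi => ?_
  have him : i ≤ m := by simpa [Nat.lt_succ_iff] using hi
  have hmN : m < N := by simp at hm; omega
  have := sum_pow_root_of_unity hN hζ him hmN
  calc _ = (B ^ i * C ^ (m - i) * m.choose i * A ^ (l - m) * l.choose m) *
        ∑ j ∈ Finset.range N, (ζ ^ j) ^ i * ((ζ ^ j)⁻¹) ^ (m - i) := by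
        rw [Finset.mul_sum]
        refine Finset.sum_congr rfl fun j _ => ?_
        rw [mul_pow, mul_pow]; ring
    _ = _ := by
      rw [this]
      split_ifs with h
      · rw [show m - i = i by omega, mul_pow]; ring
      · simp

lemma laurentConst_smul (l : ℕ) (s A P : ℂ) :
    laurentConst l (s * A) (s ^ 2 * P) = s ^ l * laurentConst l A P := by
  simp only [laurentConst, Finset.mul_sum]
  refine Finset.sum_congr rfl fun m hm => Finset.sum_congr rfl fun i hi => ?_
  split_ifs with h
  · have : l = (l - m) + 2 * i := by simp at hm; omega
    rw [mul_pow, mul_pow, ← pow_mul]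
    conv_rhs => rw [this, pow_add, ← this]
    ring
  · simp

/-- All terms are nonnegative reals, and the term m = 0 is 1. -/
lemma laurentConst_ne_zero (l : ℕ) : laurentConst l 1 (1 / 4) ≠ 0 := by
  have h : laurentConst l 1 (1 / 4) = ((∑ m ∈ Finset.range (l + 1), ∑ i ∈ Finset.range (m + 1),
      if 2 * i = m then (l.choose m : ℝ) * ((1 / 4) ^ i * m.choose i) else 0 : ℝ) : ℂ) := by
    push_cast [laurentConst]
    refine Finset.sum_congr rfl fun m _ => Finset.sum_congr rfl fun i _ => ?_
    split_ifs <;> simp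
  rw [h, Complex.ofReal_ne_zero]
  refine ne_of_gt ?_
  have hnn : ∀ m ∈ Finset.range (l + 1), ∀ i ∈ Finset.range (m + 1),
      0 ≤ if 2 * i = m then (l.choose m : ℝ) * ((1 / 4) ^ i * m.choose i) else 0 := by
    intro m _ i _
    split_ifs <;> positivity
  refine Finset.sum_pos' (fun m hm => Finset.sum_nonneg (hnn m hm)) ⟨0, by simp, by simp⟩

/-- The rotation about the `z` axis by the angle `p`. -/
def rotZ (p : ℝ) : E3 ≃ₗᵢ[ℝ] E3 :=
  LinearIsometry.toLinearIsometryEquiv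
    { toFun := fun v => !₂[v 0 * Real.cos p - v 1 * Real.sin p,
        v 0 * Real.sin p + v 1 * Real.cos p, v 2]
      map_add' := fun u v => by ext k; fin_cases k <;> simp <;> ring
      map_smul' := fun c v => by ext k; fin_cases k <;> simp <;> ring
      norm_map' := fun v => by
        simp only [EuclideanSpace.norm_eq, Fin.sum_univ_three, Real.norm_eq_abs, sq_abs]
        congr 1
        simp
        linear_combination (v 0 ^ 2 + v 1 ^ 2) * Real.sin_sq_add_cos_sq p } rfl

lemma rotZ_apply (p : ℝ) (v : E3) :
    rotZ p v = !₂[v 0 * Real.cos p - v 1 * Real.sin p, v 0 * Real.sin p + v 1 * Real.cos p, v 2] :=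
  rfl

/-- The bilinear product of the complex vector `a₁ + i a₂` with a real vector. -/
def cdot (a₁ a₂ n : E3) : ℂ := (inner ℝ a₁ n : ℝ) + Complex.I * (inner ℝ a₂ n : ℝ)

/-- The complex vector `a₁ + i a₂` is isotropic. -/
def IsIsotropic (a₁ a₂ : E3) : Prop := inner ℝ a₁ a₁ = inner ℝ a₂ a₂ ∧ inner ℝ a₁ a₂ = 0

@[fun_prop]
lemma continuous_cdot (a₁ a₂ : E3) : Continuous (cdot a₁ a₂) := by
  unfold cdot; fun_prop

lemma IsIsotropic.map {a₁ a₂ : E3} (h : IsIsotropic a₁ a₂) (e : E3 ≃ₗᵢ[ℝ] E3) :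
    IsIsotropic (e a₁) (e a₂) := by
  simpa [IsIsotropic] using h

lemma cdot_map (a₁ a₂ n : E3) (e : E3 ≃ₗᵢ[ℝ] E3) :
    cdot a₁ a₂ (e n) = cdot (e.symm a₁) (e.symm a₂) n := by
  simp [cdot, LinearIsometryEquiv.inner_map_eq_flip]

lemma cdot_eq (a₁ a₂ n : E3) : cdot a₁ a₂ n =
    (a₁ 0 + Complex.I * a₂ 0) * n 0 + (a₁ 1 + Complex.I * a₂ 1) * n 1 +
      (a₁ 2 + Complex.I * a₂ 2) * n 2 := by
  simp [cdot, PiLp.inner_apply, Fin.sum_univ_three]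
  ring

lemma IsIsotropic.sum_sq {a₁ a₂ : E3} (h : IsIsotropic a₁ a₂) :
    (a₁ 0 + Complex.I * a₂ 0) ^ 2 + (a₁ 1 + Complex.I * a₂ 1) ^ 2 +
      (a₁ 2 + Complex.I * a₂ 2) ^ 2 = 0 := by
  obtain ⟨h1, h2⟩ := h
  simp only [PiLp.inner_apply, Fin.sum_univ_three, RCLike.inner_apply, conj_trivial] at h1 h2
  have h1' := congrArg Complex.ofReal h1
  have h2' := congrArg Complex.ofReal h2
  push_cast at h1' h2'
  linear_combination h1' + 2 * Complex.I * h2' +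
    ((a₂ 0 : ℂ) ^ 2 + (a₂ 1 : ℂ) ^ 2 + (a₂ 2 : ℂ) ^ 2) * Complex.I_sq

/-- The north pole. -/
def northPole : S2 := ⟨!₂[0, 0, 1], by simp [EuclideanSpace.norm_eq, Fin.sum_univ_three]⟩

/-- With α = a₁ + i a₂ and β = b₁ + i b₂, the number α·R_p β has the form A + B e^{ip} + C e^{-ip}
with A = α_z β_z, and isotropy of both vectors forces BC = A²/4. Its l-th power has frequencies of
size at most l < N, so N equally spaced angles pick out the constant term, which by homogeneity is a
fixed multiple of A^l. -/
lemma sum_rotZ_pow {N l : ℕ} (hl : l < N) {a₁ a₂ b₁ b₂ : E3} (ha : IsIsotropic a₁ a₂)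
    (hb : IsIsotropic b₁ b₂) :
    ∑ j ∈ Finset.range N, (cdot a₁ a₂ (rotZ (2 * Real.pi * j / N) b₁) +
        Complex.I * cdot a₁ a₂ (rotZ (2 * Real.pi * j / N) b₂)) ^ l =
      N * (laurentConst l 1 (1 / 4) * (cdot b₁ b₂ northPole) ^ l * cdot a₁ a₂ northPole ^ l) := by
  have hN : N ≠ 0 := by omega
  set ζ : ℂ := Complex.exp (2 * Real.pi * Complex.I / N) with hζdef
  have hζ : IsPrimitiveRoot ζ N := Complex.isPrimitiveRoot_exp N hN
  set α : Fin 3 → ℂ := fun k => a₁ k + Complex.I * a₂ k with hα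
  set β : Fin 3 → ℂ := fun k => b₁ k + Complex.I * b₂ k with hβ
  have ha2 : α 0 ^ 2 + α 1 ^ 2 + α 2 ^ 2 = 0 := ha.sum_sq
  have hb2 : β 0 ^ 2 + β 1 ^ 2 + β 2 ^ 2 = 0 := hb.sum_sq
  have key : ∀ j : ℕ, cdot a₁ a₂ (rotZ (2 * Real.pi * j / N) b₁) +
        Complex.I * cdot a₁ a₂ (rotZ (2 * Real.pi * j / N) b₂) =
      α 2 * β 2 + ((α 0 - Complex.I * α 1) * (β 0 + Complex.I * β 1) / 2 * ζ ^ j +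
        (α 0 + Complex.I * α 1) * (β 0 - Complex.I * β 1) / 2 * (ζ ^ j)⁻¹) := by
    intro j
    have e1 : ζ ^ j = Real.cos (2 * Real.pi * j / N) + Real.sin (2 * Real.pi * j / N) * Complex.I := by
      rw [hζdef, ← Complex.exp_nat_mul, Complex.ofReal_cos, Complex.ofReal_sin, ← Complex.exp_mul_I]
      congr 1
      push_cast
      ring
    have e2 : (ζ ^ j)⁻¹ =
        Real.cos (2 * Real.pi * j / N) - Real.sin (2 * Real.pi * j / N) * Complex.I := by
      rw [e1]
      refine inv_eq_of_mul_eq_one_right ?_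
      have := Complex.sin_sq_add_cos_sq ((2 * Real.pi * j / N : ℝ) : ℂ)
      rw [← Complex.ofReal_sin, ← Complex.ofReal_cos] at this
      linear_combination this - (Real.sin (2 * Real.pi * j / N) : ℂ) ^ 2 * Complex.I_sq
    rw [e2, e1]
    simp only [cdot_eq, rotZ_apply]
    generalize Real.cos (2 * Real.pi * j / N) = c
    generalize Real.sin (2 * Real.pi * j / N) = s
    simp only [Matrix.cons_val, Complex.ofReal_sub, Complex.ofReal_add,
      Complex.ofReal_mul]
    simp only [α, β]
    linear_combination (-((a₁ 0 + Complex.I * a₂ 0) * (b₁ 1 + Complex.I * b₂ 1) * s) +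
      (a₁ 1 + Complex.I * a₂ 1) * (b₁ 1 + Complex.I * b₂ 1) * c +
      (a₁ 1 + Complex.I * a₂ 1) * (b₁ 0 + Complex.I * b₂ 0) * s) * Complex.I_sq
  simp only [key]
  rw [sum_laurent_pow hl hζ]
  have h1 : (α 0 - Complex.I * α 1) * (α 0 + Complex.I * α 1) = -α 2 ^ 2 := by
    linear_combination ha2 - α 1 ^ 2 * Complex.I_sq
  have h2 : (β 0 + Complex.I * β 1) * (β 0 - Complex.I * β 1) = -β 2 ^ 2 := by
    linear_combination hb2 - β 1 ^ 2 * Complex.I_sq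
  have hP : (α 0 - Complex.I * α 1) * (β 0 + Complex.I * β 1) / 2 *
      ((α 0 + Complex.I * α 1) * (β 0 - Complex.I * β 1) / 2) = (α 2 * β 2) ^ 2 * (1 / 4) := by
    linear_combination (1 / 4) * ((β 0 + Complex.I * β 1) * (β 0 - Complex.I * β 1)) * h1 -
      (1 / 4) * α 2 ^ 2 * h2
  have hn : ∀ c₁ c₂ : E3, cdot c₁ c₂ northPole = c₁ 2 + Complex.I * c₂ 2 := by
    intro c₁ c₂
    simp [cdot_eq, northPole]
  have := laurentConst_smul l (α 2 * β 2) 1 (1 / 4)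
  rw [mul_one] at this
  rw [hP, this, hn, hn, mul_pow]
  ring

/-- The average over the orthogonal group of `(a · g b) ^ l`, weighted with a function of `g v`. -/
lemma integral_rot_cdot_pow (h : S2 → ℂ) (hh : Continuous h) (l : ℕ) {a₁ a₂ b₁ b₂ : E3}
    (ha : IsIsotropic a₁ a₂) (hb : IsIsotropic b₁ b₂) (v : S2) :
    ∫ g : Rot, h (isoAct g.iso v) * (cdot a₁ a₂ (g.iso b₁) + Complex.I * cdot a₁ a₂ (g.iso b₂)) ^ l
        ∂rotMeasure =
      laurentConst l 1 (1 / 4) * cdot b₁ b₂ v ^ l *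
        ∫ g : Rot, h (isoAct g.iso v) * cdot a₁ a₂ (isoAct g.iso v) ^ l ∂rotMeasure := by
  obtain ⟨e, rfl⟩ := exists_isoAct_eq northPole v
  have hpole : ∀ {b₁ b₂ : E3}, IsIsotropic b₁ b₂ →
      ∫ g : Rot, h (isoAct g.iso northPole) *
        (cdot a₁ a₂ (g.iso b₁) + Complex.I * cdot a₁ a₂ (g.iso b₂)) ^ l ∂rotMeasure =
      laurentConst l 1 (1 / 4) * cdot b₁ b₂ northPole ^ l *
        ∫ g : Rot, h (isoAct g.iso northPole) * cdot a₁ a₂ (isoAct g.iso northPole) ^ l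
          ∂rotMeasure := by
    intro b₁ b₂ hb
    -- Rotations about the z axis stabilise the pole, so right invariance allows b to be replaced by
    -- R_p b without changing h(g v).
    have hfix : ∀ p, isoAct (rotZ p) northPole = northPole := by
      intro p
      ext k
      fin_cases k <;> simp [isoAct, rotZ_apply, northPole]
    have hrot : ∀ p : ℝ, ∫ g : Rot, h (isoAct g.iso northPole) *
        (cdot a₁ a₂ (g.iso b₁) + Complex.I * cdot a₁ a₂ (g.iso b₂)) ^ l ∂rotMeasure =
        ∫ g : Rot, h (isoAct g.iso northPole) *
        (cdot a₁ a₂ (g.iso (rotZ p b₁)) + Complex.I * cdot a₁ a₂ (g.iso (rotZ p b₂))) ^ l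
          ∂rotMeasure := by
      intro p
      rw [← integral_rot_mul_right _ (rotZ p)]
      refine integral_congr_ae (.of_forall fun g => ?_)
      have : isoAct (g * Unitary.linearIsometryEquiv.symm (rotZ p)).iso northPole =
          isoAct g.iso northPole := by
        conv_rhs => rw [← hfix p]
        rfl
      simp only [this]
      rfl
    have hc : ∀ x : E3, Continuous fun g : Rot => cdot a₁ a₂ (g.iso x) := fun x =>
      (continuous_cdot a₁ a₂).comp (continuous_iso_apply_const x)
    have hint : ∀ p : ℝ, Integrable (fun g : Rot => h (isoAct g.iso northPole) *
        (cdot a₁ a₂ (g.iso (rotZ p b₁)) + Complex.I * cdot a₁ a₂ (g.iso (rotZ p b₂))) ^ l)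
        rotMeasure := fun p =>
      continuous_integrable_rot ((hh.comp (continuous_isoAct_rot_const _)).mul
        (((hc _).add (continuous_const.mul (hc _))).pow l))
    -- A sum over l + 1 angles replaces the integral over the circle, being exact for degree l.
    have hsum : ((l + 1 : ℕ) : ℂ) * ∫ g : Rot, h (isoAct g.iso northPole) *
        (cdot a₁ a₂ (g.iso b₁) + Complex.I * cdot a₁ a₂ (g.iso b₂)) ^ l ∂rotMeasure =
        ∑ j ∈ Finset.range (l + 1), ∫ g : Rot, h (isoAct g.iso northPole) *
        (cdot a₁ a₂ (g.iso (rotZ (2 * Real.pi * j / (l + 1 : ℕ)) b₁)) +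
          Complex.I * cdot a₁ a₂ (g.iso (rotZ (2 * Real.pi * j / (l + 1 : ℕ)) b₂))) ^ l
          ∂rotMeasure := by
      simp only [← hrot]
      simp
    rw [← integral_finsetSum _ (fun j _ => hint _)] at hsum
    have hl : ((l + 1 : ℕ) : ℂ) ≠ 0 := Nat.cast_ne_zero.2 (by omega)
    refine mul_left_cancel₀ hl ?_
    rw [hsum, ← integral_const_mul, ← integral_const_mul]
    refine integral_congr_ae (.of_forall fun g => ?_)
    -- Moving g to the other factor, a·gx = (g⁻¹a)·x with g⁻¹a again isotropic, puts the sum in the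
    -- form of `sum_rotZ_pow`.
    simp only [← Finset.mul_sum, cdot_map a₁ a₂ _ g.iso, isoAct_coe]
    rw [sum_rotZ_pow (Nat.lt_succ_self l) (ha.map g.iso.symm) hb]
    ring
  -- Right translation by e⁻¹ takes the base point v = e(pole) back to the pole and b to e⁻¹b.
  rw [← integral_rot_mul_right _ e.symm, ← integral_rot_mul_right
    (fun g => h (isoAct g.iso (isoAct e northPole)) * _) e.symm]
  have hE : ∀ g : Rot, isoAct (g * Unitary.linearIsometryEquiv.symm e.symm).iso
      (isoAct e northPole) = isoAct g.iso northPole := by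
    intro g
    ext1
    simp
  simp only [hE, iso_mul_symm]
  rw [hpole (hb.map e.symm), isoAct_coe, cdot_map]


/-! ### The zeros of the vertex sum -/

/-- The integer sequence `2 Re ((-1 + i √6) ^ l)`. -/
def twiceRePow : ℕ → ℤ
  | 0 => 2
  | 1 => -2
  | n + 2 => -2 * twiceRePow (n + 1) - 7 * twiceRePow n

lemma sq_sqrt_six : ((Real.sqrt 6 : ℝ) : ℂ) ^ 2 = 6 := by
  rw [← Complex.ofReal_pow, Real.sq_sqrt (by norm_num)]; norm_num

lemma pow_add_pow_eq_twiceRePow (l : ℕ) :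
    (-1 + Complex.I * Real.sqrt 6) ^ l + (-1 - Complex.I * Real.sqrt 6) ^ l = twiceRePow l := by
  induction l using Nat.twoStepInduction with
  | zero => norm_num [twiceRePow]
  | one => simp [twiceRePow]; ring
  | more n h1 h2 =>
    rw [twiceRePow]
    push_cast
    rw [← h1, ← h2]
    linear_combination (Complex.I ^ 2 * ((-1 + Complex.I * Real.sqrt 6) ^ n +
      (-1 - Complex.I * Real.sqrt 6) ^ n)) * sq_sqrt_six +
      6 * ((-1 + Complex.I * Real.sqrt 6) ^ n + (-1 - Complex.I * Real.sqrt 6) ^ n) * Complex.I_sq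

lemma abs_twiceRePow_le (l : ℕ) : |(twiceRePow l : ℝ)| ≤ 2 * Real.sqrt 7 ^ l := by
  have hn : ∀ s : ℝ, s ^ 2 = 6 → ‖(-1 + Complex.I * s : ℂ)‖ = Real.sqrt 7 := by
    intro s hs
    rw [Complex.norm_def]
    congr 1
    simp [Complex.normSq_apply]
    linarith
  have h6 : Real.sqrt 6 ^ 2 = 6 := Real.sq_sqrt (by norm_num)
  have h1 := hn _ h6
  have h2 := hn (-Real.sqrt 6) (by simp)
  have : ‖((twiceRePow l : ℤ) : ℂ)‖ = |(twiceRePow l : ℝ)| := by simp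
  rw [← this, ← pow_add_pow_eq_twiceRePow]
  refine (norm_add_le _ _).trans ?_
  rw [norm_pow, norm_pow, h1, show (-1 - Complex.I * Real.sqrt 6 : ℂ) =
    -1 + Complex.I * (-Real.sqrt 6 : ℝ) by push_cast; ring, h2]
  linarith

/-- Exponent 6 is where 3^l takes over: 2 · 343 + 1 = 687 < 729. Since √7 < 3, the inequality
persists. -/
lemma two_mul_sqrt_seven_pow_lt (k : ℕ) : 2 * Real.sqrt 7 ^ (k + 6) + 1 < 3 ^ (k + 6) := by
  have h7 : Real.sqrt 7 ^ 2 = 7 := Real.sq_sqrt (by norm_num)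
  have h0 := Real.sqrt_nonneg 7
  have h3 : Real.sqrt 7 ≤ 3 := by nlinarith
  induction k with
  | zero =>
    have : Real.sqrt 7 ^ 6 = 343 := by
      rw [show Real.sqrt 7 ^ 6 = (Real.sqrt 7 ^ 2) ^ 3 by ring, h7]; norm_num
    norm_num [this]
  | succ k ih =>
    have hp : 0 ≤ Real.sqrt 7 ^ (k + 6) := by positivity
    rw [show k + 1 + 6 = (k + 6) + 1 by ring, pow_succ (Real.sqrt 7) (k + 6), pow_succ (3 : ℝ)]
    nlinarith

lemma three_pow_add_twiceRePow_eq_zero_iff (l : ℕ) :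
    (3 : ℝ) ^ l + (-1) ^ l + twiceRePow l = 0 ↔ l = 1 ∨ l = 2 ∨ l = 5 := by
  rcases lt_or_ge l 6 with h | h
  · interval_cases l <;> norm_num [twiceRePow]
  · obtain ⟨k, rfl⟩ := Nat.exists_eq_add_of_le' h
    have h1 := two_mul_sqrt_seven_pow_lt k
    have h2 := abs_le.1 (abs_twiceRePow_le (k + 6))
    have h3 : (-1 : ℝ) ≤ (-1) ^ (k + 6) := by
      rcases neg_one_pow_eq_or ℝ (k + 6) with h | h <;> rw [h]; norm_num
    constructor
    · intro h4
      linarith [h2.1]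
    · omega

lemma vertex_sum_angle (α : ℝ)
    (hα : Complex.exp (α * Complex.I) =
        ((-1 / Real.sqrt 7 : ℝ) : ℂ) + (Real.sqrt (6 / 7) : ℂ) * Complex.I) (l : ℕ) :
    1 + ((-1) ^ l + 2 * Real.sqrt 7 ^ l * Real.cos (l * α)) / 3 ^ l = 0 ↔
        l = 1 ∨ l = 2 ∨ l = 5 := by
  rw [← three_pow_add_twiceRePow_eq_zero_iff]
  have h70 : Real.sqrt 7 ≠ 0 := by positivity
  have hw : (Real.sqrt 7 : ℂ) * Complex.exp (α * Complex.I) = -1 + Complex.I * Real.sqrt 6 := by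
    rw [hα, Real.sqrt_div (by norm_num)]
    have : (Real.sqrt 7 : ℂ) ≠ 0 := by exact_mod_cast h70
    push_cast
    field_simp
  have hc : 2 * Real.sqrt 7 ^ l * Real.cos (l * α) = twiceRePow l := by
    have h1 : ((-1 + Complex.I * Real.sqrt 6) ^ l).re = Real.sqrt 7 ^ l * Real.cos (l * α) := by
      rw [← hw, mul_pow, ← Complex.exp_nat_mul, ← Complex.ofReal_pow, Complex.re_ofReal_mul,
        ← mul_assoc, ← Complex.ofReal_natCast, ← Complex.ofReal_mul, Complex.exp_ofReal_mul_I_re]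
    have h2 : (-1 - Complex.I * Real.sqrt 6 : ℂ) ^ l =
        (starRingEnd ℂ) ((-1 + Complex.I * Real.sqrt 6) ^ l) := by
      simp [sub_eq_add_neg]
    have h3 := congrArg Complex.re (pow_add_pow_eq_twiceRePow l)
    rw [h2, Complex.add_re, Complex.conj_re, h1] at h3
    simp at h3
    linarith
  rw [hc]
  have : (3 : ℝ) ^ l ≠ 0 := by positivity
  rw [← mul_eq_zero_iff_left this, mul_add, mul_div_cancel₀ _ this, mul_one, add_assoc]

/-! ### Integrals of functions with constant tetrahedral sums -/

/-- The vertices of a regular tetrahedron with a vertex on the `x` axis. -/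
def vertex : Fin 4 → S2 :=
  ![⟨!₂[1, 0, 0], by simp [EuclideanSpace.norm_eq, Fin.sum_univ_three]⟩,
    ⟨!₂[-1 / 3, 0, 2 * Real.sqrt 2 / 3], by
      simp [EuclideanSpace.norm_eq, Fin.sum_univ_three, div_pow, mul_pow]; norm_num⟩,
    ⟨!₂[-1 / 3, Real.sqrt 6 / 3, -Real.sqrt 2 / 3], by
      simp [EuclideanSpace.norm_eq, Fin.sum_univ_three, div_pow]; norm_num⟩,
    ⟨!₂[-1 / 3, -Real.sqrt 6 / 3, -Real.sqrt 2 / 3], by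
      simp [EuclideanSpace.norm_eq, Fin.sum_univ_three, div_pow]; norm_num⟩]

lemma isTetrahedron_vertex : IsTetrahedron vertex := by
  have h2 : Real.sqrt 2 * Real.sqrt 2 = 2 := Real.mul_self_sqrt (by norm_num)
  have h6 : Real.sqrt 6 * Real.sqrt 6 = 6 := Real.mul_self_sqrt (by norm_num)
  intro i j hij
  fin_cases i <;> fin_cases j <;>
    first
    | exact absurd rfl hij
    | (simp [vertex, PiLp.inner_apply, Fin.sum_univ_three] <;> nlinarith)

lemma IsTetrahedron.isoAct {n : Fin 4 → S2} (h : IsTetrahedron n) (e : E3 ≃ₗᵢ[ℝ] E3) :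
    IsTetrahedron fun j => Tetrahedral.isoAct e (n j) := fun i j hij => by
  simpa using h i j hij

lemma exists_tetrahedron (n : S2) : ∃ v : Fin 4 → S2, IsTetrahedron v ∧ v 0 = n := by
  obtain ⟨e, he⟩ := exists_isoAct_eq (vertex 0) n
  exact ⟨_, isTetrahedron_vertex.isoAct e, he⟩

/-- The integral of a function with tetrahedral sums `1`. -/
lemma integral_of_tetrahedral_sum {F : S2 → ℂ} (hF : Continuous F)
    (hsum : ∀ n, IsTetrahedron n → ∑ j, F (n j) = 1) :
    ∫ n, F n ∂sphereMeasure = Real.pi := by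
  have h1 : ∫ g : Rot, ∑ j, F (isoAct g.iso (vertex j)) ∂rotMeasure = 1 := by
    simp only [hsum _ (isTetrahedron_vertex.isoAct _)]
    simp
  have hint : ∀ j, Integrable (fun g : Rot => F (isoAct g.iso (vertex j))) rotMeasure := fun j =>
    continuous_integrable_rot (hF.comp (continuous_isoAct_rot_const _))
  rw [integral_finsetSum _ fun j _ => hint j] at h1
  have h2 := congrArg (fun z : ℂ => (4 * Real.pi : ℂ) * z) h1
  simp only [Finset.mul_sum, integral_rot_isoAct F hF] at h2
  simpa using h2

/-- A function with tetrahedral sums `1` is orthogonal to the powers of isotropic linear forms,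
but for the degrees `0`, `1`, `2` and `5`. -/
lemma integral_mul_cdot_pow_eq_zero {F : S2 → ℂ} (hF : Continuous F)
    (hsum : ∀ n, IsTetrahedron n → ∑ j, F (n j) = 1) {l : ℕ} (h0 : l ≠ 0) (h1 : l ≠ 1)
    (h2 : l ≠ 2) (h5 : l ≠ 5) {a₁ a₂ : E3} (ha : IsIsotropic a₁ a₂) :
    ∫ n, F n * cdot a₁ a₂ n ^ l ∂sphereMeasure = 0 := by
  -- For b = (1, i, 0) the products b·v_j are 1, -1/3 and (-1 ± i√6)/3. Also b is orthogonal to the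
  -- pole, which makes the average of (a·gb)^l vanish below (`hconst`).
  set b₁ : E3 := !₂[1, 0, 0]
  set b₂ : E3 := !₂[0, 1, 0]
  have hb : IsIsotropic b₁ b₂ :=
    ⟨by simp [b₁, b₂, EuclideanSpace.norm_eq, Fin.sum_univ_three],
      by simp [b₁, b₂, PiLp.inner_apply, Fin.sum_univ_three]⟩
  have hc : ∀ x : E3, Continuous fun g : Rot => cdot a₁ a₂ (g.iso x) := fun x =>
    (continuous_cdot a₁ a₂).comp (continuous_iso_apply_const x)
  have hbp : cdot b₁ b₂ northPole = 0 := by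
    simp [cdot_eq, b₁, b₂, northPole]
  have hbv : (∑ j, cdot b₁ b₂ (vertex j) ^ l) ≠ 0 := by
    have e : (∑ j, cdot b₁ b₂ (vertex j) ^ l) =
        (((3 : ℝ) ^ l + (-1) ^ l + twiceRePow l : ℝ) : ℂ) / 3 ^ l := by
      have := pow_add_pow_eq_twiceRePow l
      push_cast
      rw [← this, eq_div_iff (by positivity), Finset.sum_mul]
      simp only [← mul_pow, Fin.sum_univ_four]
      simp [cdot_eq, b₁, b₂, vertex]
      rw [show (-1 / 3 + Complex.I * (Real.sqrt 6 / 3 : ℂ)) * 3 = -1 + Complex.I * Real.sqrt 6 by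
        ring, show (-1 / 3 + Complex.I * (-Real.sqrt 6 / 3 : ℂ)) * 3 = -1 - Complex.I * Real.sqrt 6 by
        ring]
      ring
    rw [e]
    refine div_ne_zero ?_ (by positivity)
    rw [Complex.ofReal_ne_zero, Ne, three_pow_add_twiceRePow_eq_zero_iff]
    omega
  have hconst := integral_rot_cdot_pow (fun _ => 1) continuous_const l ha hb northPole
  rw [hbp, zero_pow h0, mul_zero, zero_mul] at hconst
  simp only [one_mul] at hconst
  have hv : ∀ j, ∫ g : Rot, F (isoAct g.iso (vertex j)) *
      (cdot a₁ a₂ (g.iso b₁) + Complex.I * cdot a₁ a₂ (g.iso b₂)) ^ l ∂rotMeasure =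
      cdot b₁ b₂ (vertex j) ^ l * (laurentConst l 1 (1 / 4) *
        ((4 * Real.pi : ℂ)⁻¹ * ∫ n, F n * cdot a₁ a₂ n ^ l ∂sphereMeasure)) := by
    intro j
    rw [integral_rot_cdot_pow F hF l ha hb, ← integral_rot_isoAct (fun n => F n * cdot a₁ a₂ n ^ l)
      (by fun_prop) (vertex j), inv_mul_cancel_left₀ (by simp [Real.pi_ne_zero])]
    ring
  have hs : ∑ j, ∫ g : Rot, F (isoAct g.iso (vertex j)) *
      (cdot a₁ a₂ (g.iso b₁) + Complex.I * cdot a₁ a₂ (g.iso b₂)) ^ l ∂rotMeasure = 0 := by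
    have hint : ∀ j, Integrable (fun g : Rot => F (isoAct g.iso (vertex j)) *
        (cdot a₁ a₂ (g.iso b₁) + Complex.I * cdot a₁ a₂ (g.iso b₂)) ^ l) rotMeasure := fun j =>
      continuous_integrable_rot ((hF.comp (continuous_isoAct_rot_const _)).mul
        (((hc _).add (continuous_const.mul (hc _))).pow l))
    rw [← integral_finsetSum _ fun j _ => hint j, ← hconst]
    refine integral_congr_ae (.of_forall fun g => ?_)
    simp only [← Finset.sum_mul]
    rw [hsum _ (isTetrahedron_vertex.isoAct _), one_mul]
  simp only [hv, ← Finset.sum_mul] at hs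
  have := laurentConst_ne_zero l
  simp_all [Real.pi_ne_zero]

/-! ### Spherical harmonics as combinations of isotropic powers -/

open Polynomial

/-- Since w w' = 1 - z², w (w + 2zt - w't²) = t² ((z + w/t)² - 1). The l-th power of the right side
is the Taylor expansion of (X² - 1)^l at z, with the k-th term landing on t^{2l-k}; so t^{l-m} reads
off k = l + m. -/
lemma coeff_generating (l m : ℕ) (hm : m ≤ l) {z w w' : ℂ} (h : w * w' = 1 - z ^ 2) :
    ((C w + C (2 * z) * X - C w' * X ^ 2 : ℂ[X]) ^ l).coeff (l - m) =
      w ^ m * (taylor z ((X ^ 2 - 1) ^ l)).coeff (l + m) := by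
  have main : ∀ w w' : ℂ, w ≠ 0 → w * w' = 1 - z ^ 2 →
      ((C w + C (2 * z) * X - C w' * X ^ 2 : ℂ[X]) ^ l).coeff (l - m) =
      w ^ m * (taylor z ((X ^ 2 - 1) ^ l)).coeff (l + m) := by
    intro w w' hw h
    set q := taylor z ((X ^ 2 - 1 : ℂ[X]) ^ l) with hq
    have hdeg : q.natDegree < 2 * l + 1 := by
      rw [hq, natDegree_taylor, Nat.lt_succ_iff]
      refine natDegree_pow_le.trans ?_
      rw [show (X ^ 2 - 1 : ℂ[X]) = X ^ 2 - C 1 by simp, natDegree_X_pow_sub_C, mul_comm]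
    have hpoly : C (w ^ l) * (C w + C (2 * z) * X - C w' * X ^ 2 : ℂ[X]) ^ l =
        ∑ k ∈ Finset.range (2 * l + 1), C (q.coeff k * w ^ k) * X ^ (2 * l - k) := by
      refine eq_of_infinite_eval_eq _ _ (Set.Infinite.mono (s := {t : ℂ | t ≠ 0}) ?_ ?_)
      · intro t (ht : t ≠ 0)
        have h1 : q.eval (w / t) = ((z + w / t) ^ 2 - 1) ^ l := by
          simp [hq, add_comm]
        rw [eval_eq_sum_range' hdeg] at h1
        simp only [Set.mem_ofPred_eq, eval_mul, eval_C, eval_pow, eval_sub, eval_add, eval_X,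
          eval_finsetSum]
        rw [← mul_pow]
        have h2 : w * (w + 2 * z * t - w' * t ^ 2) = t ^ 2 * ((z + w / t) ^ 2 - 1) := by
          field_simp
          linear_combination - t ^ 2 * h
        rw [h2, mul_pow, ← h1, Finset.mul_sum]
        refine Finset.sum_congr rfl fun k hk => ?_
        have : 2 * l = (2 * l - k) + k := by simp at hk; omega
        rw [← pow_mul]
        conv_lhs => rw [this, pow_add, div_pow]
        field_simp
      · exact Set.Finite.infinite_compl (Set.finite_singleton (0 : ℂ))
    have hc := congrArg (fun p : ℂ[X] => p.coeff (l - m)) hpoly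
    simp only [coeff_C_mul, finsetSum_coeff, coeff_X_pow] at hc
    rw [Finset.sum_eq_single (l + m)] at hc
    · rw [if_pos (by omega), mul_one, pow_add] at hc
      have : w ^ l ≠ 0 := pow_ne_zero _ hw
      refine mul_left_cancel₀ this ?_
      rw [hc]; ring
    · intro k hk hkm
      rw [if_neg, mul_zero]
      simp at hk
      omega
    · intro hk
      simp at hk
      omega
  by_cases hw : w = 0
  · subst hw
    have hz : 1 - z ^ 2 = 0 := by rw [← h, zero_mul]
    rw [show (C 0 + C (2 * z) * X - C w' * X ^ 2 : ℂ[X]) ^ l = X ^ l * (C (2 * z) - C w' * X) ^ l by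
      rw [← mul_pow, C_0]; ring, coeff_X_pow_mul']
    -- At a pole w = 0 nothing can be cancelled. For m = 0 the right side depends only on z, so the
    -- case w = 1, w' = 0 supplies it; for m > 0 both sides vanish.
    rcases Nat.eq_zero_or_pos m with rfl | hm0
    · have h1 := main 1 0 one_ne_zero (by rw [hz, mul_zero])
      have h2 : ((C 1 + C (2 * z) * X - C 0 * X ^ 2 : ℂ[X]) ^ l).coeff l = (2 * z) ^ l := by
        have h3 := coeff_pow_of_natDegree_le (m := l) (n := 1)
          (show (C (2 * z) * X + C 1 : ℂ[X]).natDegree ≤ 1 from natDegree_linear_le)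
        rw [mul_one] at h3
        rw [C_0, zero_mul, sub_zero, add_comm, h3]
        simp [coeff_one]
      rw [pow_zero, ← pow_zero (1 : ℂ), ← h1, Nat.sub_zero, h2, if_pos le_rfl, Nat.sub_self,
        coeff_zero_eq_eval_zero]
      simp
    · rw [if_neg (by omega), zero_pow hm0.ne', zero_mul]
  · exact main w w' hw h

/-- By the formula of Rodrigues the m-th derivative of P_l is, up to a constant, the Taylor
coefficient of index l + m in `coeff_generating`. -/
lemma sphHarmNat_eq_coeff (l m : ℕ) (hm : m ≤ l) : ∃ K : ℂ, ∀ n : S2, sphHarmNat l m n =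
    K * ((C ((n.1 0 : ℂ) + n.1 1 * Complex.I) + C (2 * (n.1 2 : ℂ)) * X -
      C ((n.1 0 : ℂ) - n.1 1 * Complex.I) * X ^ 2 : ℂ[X]) ^ l).coeff (l - m) := by
  refine ⟨((normConst l m * ((-1) ^ m * (1 / (2 ^ l * (l ! : ℝ)))) : ℝ) : ℂ) * (l + m)!, fun n => ?_⟩
  have hn : ((n.1 0 : ℝ) : ℂ) ^ 2 + (n.1 1 : ℂ) ^ 2 + (n.1 2 : ℂ) ^ 2 = 1 := by
    have := norm_eq_of_mem_sphere n
    rw [EuclideanSpace.norm_eq, Real.sqrt_eq_one, Fin.sum_univ_three] at this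
    simp only [Real.norm_eq_abs, sq_abs] at this
    exact_mod_cast this
  rw [coeff_generating l m hm (z := n.1 2) (by
    linear_combination hn - (n.1 1 : ℂ) ^ 2 * Complex.I_sq)]
  have h1 : (((derivative^[m] (legendre l)).eval (n.1 2) : ℝ) : ℂ) =
      ((1 / (2 ^ l * (l ! : ℝ)) : ℝ) : ℂ) * ((l + m)! *
        (taylor (n.1 2 : ℂ) ((X ^ 2 - 1) ^ l)).coeff (l + m)) := by
    rw [legendre, iterate_derivative_C_mul, ← Function.iterate_add_apply, add_comm m l, eval_C_mul,
      taylor_coeff, ← nsmul_eq_mul ((l + m)!), ← eval_smul, ← LinearMap.smul_apply,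
      factorial_smul_hasseDeriv, Complex.ofReal_mul]
    congr 1
    have h2 : ((X ^ 2 - 1) ^ l : ℂ[X]) = ((X ^ 2 - 1) ^ l : ℝ[X]).map Complex.ofRealHom := by simp
    rw [h2, iterate_derivative_map, ← Complex.ofRealHom_eq_coe, ← Complex.ofRealHom_eq_coe,
      eval_map_apply]
  rw [sphHarmNat, Complex.ofReal_mul, Complex.ofReal_mul ((-1) ^ m), h1]
  push_cast
  ring

/-- The spherical harmonics are combinations of powers of isotropic linear forms. -/
lemma exists_sphHarmNat_eq_sum (l m : ℕ) (hm : m ≤ l) :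
    ∃ (N : ℕ) (c : ℕ → ℂ) (a₁ a₂ : ℕ → E3), (∀ i, IsIsotropic (a₁ i) (a₂ i)) ∧
      ∀ n : S2, sphHarmNat l m n = ∑ i ∈ Finset.range N, c i * cdot (a₁ i) (a₂ i) n ^ l := by
  obtain ⟨K, hK⟩ := sphHarmNat_eq_coeff l m hm
  -- The generating polynomial at t is (a·n)^l with a = (1 - t², i(1 + t²), 2t), isotropic for real
  -- t. It has degree at most 2l in t, so Lagrange interpolation at t = 0, ..., 2l recovers the
  -- coefficient from its values.
  refine ⟨2 * l + 1, fun i => K * (Lagrange.basis (Finset.range (2 * l + 1))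
    (fun i : ℕ => (i : ℂ)) i).coeff (l - m), fun t => !₂[1 - (t : ℝ) ^ 2, 0, 2 * t],
    fun t => !₂[0, 1 + (t : ℝ) ^ 2, 0], fun t => ⟨?_, ?_⟩, fun n => ?_⟩
  · simp only [PiLp.inner_apply, Fin.sum_univ_three]
    simp
    ring
  · simp [PiLp.inner_apply, Fin.sum_univ_three]
  · rw [hK]
    set p : ℂ[X] := (C ((n.1 0 : ℂ) + n.1 1 * Complex.I) + C (2 * (n.1 2 : ℂ)) * X -
      C ((n.1 0 : ℂ) - n.1 1 * Complex.I) * X ^ 2) ^ l with hp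
    have hd : p.degree < (Finset.range (2 * l + 1)).card := by
      rw [Finset.card_range]
      refine degree_le_natDegree.trans_lt ?_
      rw [Nat.cast_lt, Nat.lt_succ_iff, mul_comm]
      refine natDegree_pow_le_of_le l ?_
      compute_degree
    have hinj : Set.InjOn (fun i : ℕ => (i : ℂ)) (Finset.range (2 * l + 1)) :=
      Nat.cast_injective.injOn
    conv_lhs => rw [Lagrange.eq_interpolate hinj hd]
    rw [Lagrange.interpolate_apply, finsetSum_coeff, Finset.mul_sum]
    refine Finset.sum_congr rfl fun i _ => ?_
    have he : p.eval (i : ℂ) =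
        cdot (!₂[1 - (i : ℝ) ^ 2, 0, 2 * i]) (!₂[0, 1 + (i : ℝ) ^ 2, 0]) n ^ l := by
      rw [hp, eval_pow, cdot_eq]
      congr 1
      simp
      ring
    rw [coeff_C_mul, he]
    ring

/-! ### Vanishing power sums over tetrahedra -/

/-- The vertices of a regular tetrahedron form a tight frame. -/
lemma IsTetrahedron.frame {n : Fin 4 → S2} (hn : IsTetrahedron n) :
    (∀ p : Fin 3, ∑ j, (n j).1 p = 0) ∧
      ∀ p q : Fin 3, ∑ j, (n j).1 p * (n j).1 q = if p = q then 4 / 3 else 0 := by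
  -- The entries of Q R are (3/4) n_i·n_j + 1/4 = δ_ij. For square matrices R Q = 1 follows, and its
  -- entries are the frame relations.
  let Q : Matrix (Fin 4) (Fin 4) ℝ := fun j => ![(n j).1 0, (n j).1 1, (n j).1 2, 1]
  let R : Matrix (Fin 4) (Fin 4) ℝ := fun p j =>
    ![3 / 4 * (n j).1 0, 3 / 4 * (n j).1 1, 3 / 4 * (n j).1 2, 1 / 4] p
  have hin : ∀ i j, (n i).1 0 * (n j).1 0 + (n i).1 1 * (n j).1 1 + (n i).1 2 * (n j).1 2 =
      if i = j then 1 else -1 / 3 := by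
    intro i j
    have h : inner ℝ (n i : E3) (n j : E3) = if i = j then 1 else -1 / 3 := by
      split_ifs with hij
      · subst hij
        rw [real_inner_self_eq_norm_sq, norm_eq_of_mem_sphere, one_pow]
      · exact hn i j hij
    rw [← h]
    simp only [PiLp.inner_apply, Fin.sum_univ_three, RCLike.inner_apply, conj_trivial]
    ring
  have hQR : Q * R = 1 := by
    ext i j
    rw [Matrix.mul_apply, Fin.sum_univ_four, Matrix.one_apply]
    have := hin i j
    simp only [Q, R, Matrix.cons_val]
    split_ifs at this ⊢ <;> linarith
  have hRQ : ∀ p q, ∑ j, R p j * Q j q = if p = q then 1 else 0 := by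
    intro p q
    rw [← Matrix.mul_apply, mul_eq_one_comm.1 hQR, Matrix.one_apply]
  have hR : ∀ (p : Fin 3) j, R p.castSucc j = 3 / 4 * (n j).1 p := by
    intro p j; fin_cases p <;> rfl
  have hQ : ∀ (p : Fin 3) j, Q j p.castSucc = (n j).1 p := by
    intro p j; fin_cases p <;> rfl
  have hQ3 : ∀ j, Q j 3 = 1 := fun j => rfl
  constructor
  · intro p
    have := hRQ p.castSucc 3
    simp only [hR, hQ3, mul_one, ← Finset.mul_sum] at this
    rw [if_neg (show p.castSucc ≠ (3 : Fin 4) from (Fin.castSucc_lt_last p).ne)] at this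
    linarith
  · intro p q
    have := hRQ p.castSucc q.castSucc
    simp only [hR, hQ, mul_assoc, ← Finset.mul_sum, Fin.castSucc_inj] at this
    split_ifs at this ⊢ <;> linarith

/-- The sum of a power of an isotropic linear form over the vertices of a regular tetrahedron. -/
lemma tetrahedral_sum_cdot_pow {l : ℕ} (hl : l = 1 ∨ l = 2 ∨ l = 5) {a₁ a₂ : E3}
    (ha : IsIsotropic a₁ a₂) {n : Fin 4 → S2} (hn : IsTetrahedron n) :
    ∑ j, cdot a₁ a₂ (n j) ^ l = 0 := by
  have h1 : ∀ p : Fin 3, ∑ j, ((n j).1 p : ℂ) = 0 := fun p => by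
    rw [← Complex.ofReal_sum, hn.frame.1 p, Complex.ofReal_zero]
  have h2 : ∀ p q : Fin 3, ∑ j, ((n j).1 p : ℂ) * (n j).1 q = if p = q then 4 / 3 else 0 := by
    intro p q
    have := congrArg Complex.ofReal (hn.frame.2 p q)
    push_cast at this
    rw [this]
    split_ifs <;> simp
  have hs := ha.sum_sq
  have p1 : ∑ j, cdot a₁ a₂ (n j) = 0 := by
    simp only [cdot_eq, Finset.sum_add_distrib, ← Finset.mul_sum, h1]
    simp
  have p2 : ∑ j, cdot a₁ a₂ (n j) ^ 2 = 0 := by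
    simp only [cdot_eq]
    generalize (a₁ 0 + Complex.I * a₂ 0 : ℂ) = x at *
    generalize (a₁ 1 + Complex.I * a₂ 1 : ℂ) = y at *
    generalize (a₁ 2 + Complex.I * a₂ 2 : ℂ) = z at *
    have : ∀ j, (x * (n j).1 0 + y * (n j).1 1 + z * (n j).1 2) ^ 2 =
        x ^ 2 * ((n j).1 0 * (n j).1 0) + y ^ 2 * ((n j).1 1 * (n j).1 1) +
        z ^ 2 * ((n j).1 2 * (n j).1 2) + 2 * x * y * ((n j).1 0 * (n j).1 1) +
        2 * x * z * ((n j).1 0 * (n j).1 2) + 2 * y * z * ((n j).1 1 * (n j).1 2) := by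
      intro j; ring
    simp only [this, Finset.sum_add_distrib, ← Finset.mul_sum, h2]
    simp
    linear_combination (4 / 3) * hs
  rw [Fin.sum_univ_four] at *
  generalize cdot a₁ a₂ (n 0) = s₀ at *
  generalize cdot a₁ a₂ (n 1) = s₁ at *
  generalize cdot a₁ a₂ (n 2) = s₂ at *
  generalize cdot a₁ a₂ (n 3) = s₃ at *
  obtain rfl : s₃ = -(s₀ + s₁ + s₂) := by linear_combination p1
  rcases hl with rfl | rfl | rfl
  · ring
  · exact p2
  -- For four numbers of sum 0, p₅ = (5/6) p₂ p₃ and p₃ = -3 (s₀ + s₁)(s₁ + s₂)(s₀ + s₂).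
  · linear_combination -(5 / 2) * (s₀ + s₁) * (s₁ + s₂) * (s₀ + s₂) * p2

/-! ### Integrals of polynomials in the third coordinate -/

@[fun_prop]
lemma continuous_coord (k : Fin 3) : Continuous fun n : S2 => n.1 k := by fun_prop

lemma sum_sq_coord (n : S2) : n.1 0 ^ 2 + n.1 1 ^ 2 + n.1 2 ^ 2 = 1 := by
  have := norm_eq_of_mem_sphere n
  rw [EuclideanSpace.norm_eq, Real.sqrt_eq_one, Fin.sum_univ_three] at this
  simpa only [Real.norm_eq_abs, sq_abs] using this

/-- The integral over the sphere of a polynomial in the third coordinate. -/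
def zInt (p : ℝ[X]) : ℝ := ∫ n, p.eval (n.1 2) ∂sphereMeasure

lemma integrable_eval (p : ℝ[X]) : Integrable (fun n : S2 => p.eval (n.1 2)) sphereMeasure :=
  continuous_integrable (p.continuous.comp (continuous_coord 2))

lemma zInt_add (p q : ℝ[X]) : zInt (p + q) = zInt p + zInt q := by
  simp only [zInt, eval_add]
  exact integral_add (integrable_eval p) (integrable_eval q)

lemma zInt_C_mul (c : ℝ) (p : ℝ[X]) : zInt (C c * p) = c * zInt p := by
  simp only [zInt, eval_mul, eval_C, integral_const_mul]

lemma zInt_one : zInt 1 = 4 * Real.pi := by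
  simp only [zInt, eval_one, integral_const, sphereMeasure_univ, smul_eq_mul, mul_one]

lemma zInt_X_pow_odd {k : ℕ} (hk : Odd k) : zInt (X ^ k) = 0 := by
  have h := integral_isoAct (LinearIsometryEquiv.neg ℝ) (fun n : S2 => (X ^ k : ℝ[X]).eval (n.1 2))
    ((X ^ k : ℝ[X]).continuous.comp (continuous_coord 2))
  simp only [isoAct_coe, eval_pow, eval_X, LinearIsometryEquiv.coe_neg, PiLp.neg_apply, hk.neg_pow,
    integral_neg] at h
  simp only [zInt, eval_pow, eval_X]
  linarith

/-- The form t x + z is √(1 + t²) times the product with a unit vector, which an isometry moves to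
the pole. -/
lemma integral_linear_pow (k : ℕ) (t : ℝ) :
    ∫ n : S2, (t * n.1 0 + n.1 2) ^ k ∂sphereMeasure =
      Real.sqrt (1 + t ^ 2) ^ k * zInt (X ^ k) := by
  set r := Real.sqrt (1 + t ^ 2) with hr
  have hr2 : r ^ 2 = 1 + t ^ 2 := Real.sq_sqrt (by positivity)
  have hr0 : r ≠ 0 := by positivity
  let u : S2 := ⟨!₂[t / r, 0, 1 / r], by
    simp [EuclideanSpace.norm_eq, Fin.sum_univ_three, div_pow, hr2]
    field_simp
    linarith⟩
  obtain ⟨e, he⟩ := exists_isoAct_eq northPole u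
  have h := integral_isoAct e (fun n : S2 => (t * n.1 0 + n.1 2) ^ k) (by fun_prop)
  rw [← h, zInt, ← integral_const_mul]
  refine integral_congr_ae (.of_forall fun n => ?_)
  have h1 : inner ℝ (u : E3) (e n.1) = n.1 2 := by
    rw [← he, isoAct_coe, LinearIsometryEquiv.inner_map_map]
    simp [northPole, PiLp.inner_apply, Fin.sum_univ_three]
  simp only [PiLp.inner_apply, Fin.sum_univ_three, RCLike.inner_apply, conj_trivial, u,
    Matrix.cons_val] at h1
  simp only [isoAct_coe, eval_pow, eval_X, ← mul_pow]
  congr 1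
  rw [← h1]
  field_simp
  ring

/-- Both sides of `integral_linear_pow` with exponent 2j + 2 are polynomials in t; this compares
their coefficients of t². -/
lemma integral_sq_mul_pow (j : ℕ) :
    (2 * j + 1) * ∫ n : S2, n.1 0 ^ 2 * n.1 2 ^ (2 * j) ∂sphereMeasure =
      zInt (X ^ (2 * j + 2)) := by
  set c : ℕ → ℝ := fun i => ∫ n : S2, n.1 0 ^ i * n.1 2 ^ (2 * j + 2 - i) ∂sphereMeasure with hc
  have hpoly : ∑ i ∈ Finset.range (2 * j + 2 + 1), C (c i * (2 * j + 2).choose i) * X ^ i =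
      C (zInt (X ^ (2 * j + 2))) * expand ℝ 2 ((1 + X) ^ (j + 1)) := by
    refine funext fun t => ?_
    have h := integral_linear_pow (2 * j + 2) t
    rw [show 2 * j + 2 = 2 * (j + 1) by ring, pow_mul, Real.sq_sqrt (by positivity)] at h
    rw [← show 2 * j + 2 = 2 * (j + 1) by ring] at h
    simp only [expand_eval, eval_mul, eval_C, eval_pow, eval_add, eval_one, eval_X,
      eval_finsetSum]
    rw [mul_comm (zInt _), ← h]
    simp only [add_pow]
    rw [integral_finsetSum]
    · refine Finset.sum_congr rfl fun i _ => ?_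
      simp only [hc]
      rw [← integral_mul_const, ← integral_mul_const]
      refine integral_congr_ae (.of_forall fun n => ?_)
      simp only [mul_pow]
      ring
    · exact fun i _ => continuous_integrable (by fun_prop)
  have h2 := congrArg (fun p : ℝ[X] => p.coeff (2 * 1)) hpoly
  simp only [finsetSum_coeff, coeff_C_mul, coeff_expand_mul' two_pos, coeff_X_pow] at h2
  rw [Finset.sum_eq_single 2 (by intro b _ hb; rw [if_neg (by omega), mul_zero]) (by simp),
    add_comm (1 : ℝ[X]) X, coeff_X_add_one_pow, if_pos (by rfl), Nat.choose_one_right,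
    Nat.cast_choose_two] at h2
  have hj : ((j : ℝ) + 1) ≠ 0 := by positivity
  refine mul_left_cancel₀ hj ?_
  push_cast at h2
  simp only [hc, Nat.add_sub_cancel] at h2
  linear_combination h2

/-- Integrating (x² + y² + z²) z^{2j} = z^{2j}, with x² and y² contributing equally, gives a
recursion in j. -/
lemma zInt_X_pow_even (j : ℕ) : (2 * j + 1) * zInt (X ^ (2 * j)) = 4 * Real.pi := by
  induction j with
  | zero => simp [zInt_one]
  | succ j ih =>
    have h1 := integral_sq_mul_pow j
    have h2 : ∫ n : S2, n.1 1 ^ 2 * n.1 2 ^ (2 * j) ∂sphereMeasure =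
        ∫ n : S2, n.1 0 ^ 2 * n.1 2 ^ (2 * j) ∂sphereMeasure := by
      rw [← integral_isoAct (rotZ (Real.pi / 2)) (fun n : S2 => n.1 1 ^ 2 * n.1 2 ^ (2 * j))
        (by fun_prop)]
      simp [rotZ_apply]
    have h3 : (∫ n : S2, n.1 0 ^ 2 * n.1 2 ^ (2 * j) ∂sphereMeasure) +
        (∫ n : S2, n.1 1 ^ 2 * n.1 2 ^ (2 * j) ∂sphereMeasure) + zInt (X ^ (2 * j + 2)) =
        zInt (X ^ (2 * j)) := by
      simp only [zInt, eval_pow, eval_X]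
      rw [← integral_add (continuous_integrable (by fun_prop)) (continuous_integrable (by fun_prop)),
        ← integral_add (continuous_integrable (by fun_prop)) (continuous_integrable (by fun_prop))]
      refine integral_congr_ae (.of_forall fun n => ?_)
      simp only []
      linear_combination (n.1 2 ^ (2 * j)) * sum_sq_coord n
    rw [h2] at h3
    rw [show 2 * (j + 1) = 2 * j + 2 by ring]
    push_cast
    linear_combination ih - 2 * h1 + (2 * j + 1) * h3

/-- The fundamental theorem of calculus in the third coordinate. -/
lemma zInt_derivative (p : ℝ[X]) :
    zInt (derivative p) = 2 * Real.pi * (p.eval 1 - p.eval (-1)) := by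
  induction p using Polynomial.induction_on' with
  | add p q hp hq =>
    rw [derivative_add, zInt_add, hp, hq, eval_add, eval_add]
    ring
  | monomial k a =>
    rw [derivative_monomial, ← C_mul_X_pow_eq_monomial, zInt_C_mul, eval_monomial, eval_monomial]
    rcases Nat.even_or_odd' k with ⟨j, rfl | rfl⟩
    · rcases Nat.eq_zero_or_pos j with rfl | hj
      · simp
      · rw [zInt_X_pow_odd (by exact ⟨j - 1, by omega⟩)]
        simp
    · rw [Nat.add_sub_cancel]
      have := zInt_X_pow_even j
      rw [pow_succ (-1 : ℝ), (even_two_mul j).neg_one_pow, one_pow]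
      push_cast
      linear_combination a * this

lemma zInt_by_parts (p q : ℝ[X]) :
    zInt (derivative p * q) = 2 * Real.pi * ((p * q).eval 1 - (p * q).eval (-1)) -
      zInt (p * derivative q) := by
  rw [← zInt_derivative, derivative_mul, zInt_add]
  ring

/-! ### Orthogonality of the associated Legendre functions -/

lemma eval_iterate_derivative_eq_zero {p : ℝ[X]} {N k : ℕ} (hk : k < N) (q : ℝ[X]) {a : ℝ}
    (ha : p.eval a = 0) : (derivative^[k] (p ^ N * q)).eval a = 0 := by
  have h := pow_sub_dvd_iterate_derivative_of_pow_dvd k (Dvd.intro q rfl : p ^ N ∣ p ^ N * q)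
  obtain ⟨r, hr⟩ := (dvd_pow_self p (by omega : N - k ≠ 0)).trans h
  rw [hr, eval_mul, ha, zero_mul]

/-- Integration by parts l + m times. In the boundary terms at ±1, either (1 - X²)^m has been
differentiated fewer than m times or (X² - 1)^l fewer than l times, so a zero always survives. -/
lemma zInt_rodrigues (l m : ℕ) (q : ℝ[X]) :
    zInt (derivative^[l + m] ((X ^ 2 - 1) ^ l) * ((1 - X ^ 2) ^ m * q)) =
      (-1) ^ (l + m) * zInt ((X ^ 2 - 1) ^ l * derivative^[l + m] ((1 - X ^ 2) ^ m * q)) := by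
  have main : ∀ i ≤ l + m,
      zInt (derivative^[l + m] ((X ^ 2 - 1) ^ l) * ((1 - X ^ 2) ^ m * q)) =
      (-1) ^ i * zInt (derivative^[l + m - i] ((X ^ 2 - 1) ^ l) *
        derivative^[i] ((1 - X ^ 2) ^ m * q)) := by
    intro i
    induction i with
    | zero => simp
    | succ i ih =>
      intro hi
      rw [ih (by omega), show l + m - i = (l + m - (i + 1)) + 1 by omega,
        Function.iterate_succ_apply', zInt_by_parts, ← Function.iterate_succ_apply' derivative i]
      have hb : ∀ a : ℝ, a ^ 2 = 1 → (derivative^[l + m - (i + 1)] ((X ^ 2 - 1) ^ l) *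
          derivative^[i] ((1 - X ^ 2) ^ m * q)).eval a = 0 := by
        intro a ha
        rw [eval_mul]
        rcases lt_or_ge i m with him | him
        · rw [eval_iterate_derivative_eq_zero him q (by simp [ha]), mul_zero]
        · have := eval_iterate_derivative_eq_zero (p := X ^ 2 - 1) (N := l)
            (k := l + m - (i + 1)) (by omega) 1 (a := a) (by simp [ha])
          rw [mul_one] at this
          rw [this, zero_mul]
      rw [hb 1 (by norm_num), hb (-1) (by norm_num), pow_succ]
      ring
  simpa using main (l + m) le_rfl

/-- The derivative of X (X² - 1)^{l+1} has integral 0, which links consecutive exponents. -/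
lemma zInt_sq_sub_one_pow (l : ℕ) :
    (2 * l + 1)! * zInt ((X ^ 2 - 1) ^ l) = (-1) ^ l * (4 * Real.pi) * (2 ^ l * l !) ^ 2 := by
  induction l with
  | zero => simp [zInt_one]
  | succ l ih =>
    have h := zInt_derivative (X * (X ^ 2 - 1) ^ (l + 1))
    have h1 : derivative (X * (X ^ 2 - 1) ^ (l + 1) : ℝ[X]) =
        C (2 * l + 3 : ℝ) * (X ^ 2 - 1) ^ (l + 1) + C (2 * l + 2 : ℝ) * (X ^ 2 - 1) ^ l := by
      have h2 : (C 2 : ℝ[X]) = 2 := rfl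
      have h3 : (C 3 : ℝ[X]) = 3 := rfl
      rw [derivative_mul, derivative_pow_succ]
      simp [h2, h3]
      ring
    rw [h1, zInt_add, zInt_C_mul, zInt_C_mul] at h
    simp at h
    rw [show 2 * (l + 1) + 1 = (2 * l + 1) + 1 + 1 by ring, Nat.factorial_succ, Nat.factorial_succ,
      Nat.factorial_succ l]
    push_cast
    linear_combination (2 * l + 2) * (2 * l + 1)! * h - (2 * l + 2) ^ 2 * ih

lemma natDegree_sq_sub_one_pow (l : ℕ) : ((X ^ 2 - 1 : ℝ[X]) ^ l).natDegree = 2 * l := by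
  rw [natDegree_pow, show (X ^ 2 - 1 : ℝ[X]) = X ^ 2 - C 1 by simp, natDegree_X_pow_sub_C, mul_comm]

lemma coeff_sq_sub_one_pow (l : ℕ) : ((X ^ 2 - 1 : ℝ[X]) ^ l).coeff (2 * l) = 1 := by
  have h : ((X ^ 2 - 1 : ℝ[X]) ^ l).Monic := by
    rw [show (X ^ 2 - 1 : ℝ[X]) = X ^ 2 - C 1 by simp]
    exact (monic_X_pow_sub_C _ two_ne_zero).pow l
  rw [← natDegree_sq_sub_one_pow]
  exact h

/-- The orthogonality relations of the associated Legendre functions. -/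
lemma zInt_rodrigues_mul (l l' m : ℕ) (hm : m ≤ l) (hll : l ≤ l') :
    zInt (derivative^[l' + m] ((X ^ 2 - 1) ^ l') *
        ((1 - X ^ 2) ^ m * derivative^[l + m] ((X ^ 2 - 1) ^ l))) =
      if l = l' then 4 * Real.pi / (2 * l + 1) * (2 ^ l * l !) ^ 2 *
        (((l + m)! : ℝ) / ((l - m)! : ℝ)) else 0 := by
  rw [zInt_rodrigues]
  have hd1 : ((1 - X ^ 2 : ℝ[X]) ^ m).natDegree ≤ 2 * m := by
    rw [mul_comm]
    exact natDegree_pow_le_of_le m (by compute_degree)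
  have hd2 : (derivative^[l + m] ((X ^ 2 - 1 : ℝ[X]) ^ l)).natDegree ≤ l - m := by
    refine (natDegree_iterate_derivative _ _).trans ?_
    rw [natDegree_sq_sub_one_pow]
    omega
  have hd : ((1 - X ^ 2 : ℝ[X]) ^ m * derivative^[l + m] ((X ^ 2 - 1) ^ l)).natDegree ≤ l + m := by
    refine (natDegree_mul_le_of_le hd1 hd2).trans ?_
    omega
  -- The factor being differentiated l' + m times has degree at most l + m. For l < l' nothing
  -- remains; for l = l' only the leading coefficient does.
  split_ifs with h
  · subst h
    have h0 := natDegree_iterate_derivative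
      ((1 - X ^ 2 : ℝ[X]) ^ m * derivative^[l + m] ((X ^ 2 - 1) ^ l)) (l + m)
    have hc := eq_C_of_natDegree_le_zero (h0.trans (by omega))
    have hcoeff : ((1 - X ^ 2 : ℝ[X]) ^ m * derivative^[l + m] ((X ^ 2 - 1) ^ l)).coeff (l + m) =
        (-1) ^ m * (((2 * l)! : ℝ) / ((l - m)! : ℝ)) := by
      rw [show l + m = 2 * m + (l - m) by omega, coeff_mul_add_eq_of_natDegree_le hd1
        (by rwa [show 2 * m + (l - m) = l + m by omega]), coeff_iterate_derivative,
        show l - m + (2 * m + (l - m)) = 2 * l by omega, coeff_sq_sub_one_pow,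
        show 2 * m = m * 2 by ring, coeff_pow_of_natDegree_le (by compute_degree),
        nsmul_eq_mul, mul_one, Nat.descFactorial_eq_div (by omega),
        Nat.cast_div (Nat.factorial_dvd_factorial (by omega)) (by positivity),
        show 2 * l - (m * 2 + (l - m)) = l - m by omega]
      simp [coeff_one]
    rw [coeff_iterate_derivative, zero_add, hcoeff, Nat.descFactorial_self, nsmul_eq_mul] at hc
    rw [hc, mul_comm ((X ^ 2 - 1) ^ l), zInt_C_mul]
    have hz := zInt_sq_sub_one_pow l
    rw [Nat.factorial_succ] at hz
    push_cast at hz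
    have h1 : ((l - m)! : ℝ) ≠ 0 := by positivity
    have h2 : (2 * (l : ℝ) + 1) ≠ 0 := by positivity
    have h3 : ((-1 : ℝ) ^ l) * (-1) ^ l = 1 := by rw [← mul_pow]; simp
    have h4 : ((-1 : ℝ) ^ m) * (-1) ^ m = 1 := by rw [← mul_pow]; simp
    field_simp
    rw [pow_add]
    linear_combination (-1) ^ l * ((-1) ^ m * (-1) ^ m) * hz +
      4 * Real.pi * (2 ^ l * (l ! : ℝ)) ^ 2 * ((-1 : ℝ) ^ m * (-1) ^ m * h3 + h4)
  · rw [iterate_derivative_eq_zero (by omega), mul_zero]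
    simp [zInt]

lemma iterate_derivative_legendre (l m : ℕ) : derivative^[m] (legendre l) =
    C (1 / (2 ^ l * (l ! : ℝ))) * derivative^[l + m] ((X ^ 2 - 1) ^ l) := by
  rw [legendre, iterate_derivative_C_mul, ← Function.iterate_add_apply, add_comm m l]

lemma normConst_mul_zInt (l l' m : ℕ) (hm : m ≤ l) (hm' : m ≤ l') :
    normConst l m * normConst l' m * zInt ((1 - X ^ 2) ^ m *
      (derivative^[m] (legendre l) * derivative^[m] (legendre l'))) = if l = l' then 1 else 0 := by
  wlog hll : l ≤ l' generalizing l l'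
  · have := this l' l hm' hm (by omega)
    rw [mul_comm (normConst l m), mul_comm (derivative^[m] (legendre l)), this]
    simp only [eq_comm]
  have h := zInt_rodrigues_mul l l' m hm hll
  rw [iterate_derivative_legendre, iterate_derivative_legendre,
    show ∀ a b c d e : ℝ[X], a * ((b * c) * (d * e)) = b * (d * (e * (a * c))) by intros; ring,
    zInt_C_mul, zInt_C_mul, h]
  split_ifs with hl
  · subst hl
    rw [normConst, ← mul_assoc, Real.mul_self_sqrt (by positivity)]
    have := Real.pi_ne_zero
    field_simp
  · simp

/-! ### Orthonormality of the spherical harmonics -/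

/-- The azimuthal factor `(n_x + i n_y) ^ m`, with the conjugate base for negative `m`. -/
def azimuth (m : ℤ) (n : S2) : ℂ :=
  if 0 ≤ m then ((n.1 0 : ℂ) + (n.1 1 : ℂ) * Complex.I) ^ m.natAbs
  else ((n.1 0 : ℂ) - (n.1 1 : ℂ) * Complex.I) ^ m.natAbs

@[fun_prop]
lemma continuous_azimuth (m : ℤ) : Continuous (azimuth m) := by
  unfold azimuth
  split_ifs <;> fun_prop

lemma azimuth_neg (m : ℤ) (n : S2) : azimuth (-m) n = (starRingEnd ℂ) (azimuth m n) := by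
  rcases lt_trichotomy m 0 with h | rfl | h
  · rw [azimuth, azimuth, if_pos (by omega), if_neg (by omega)]
    simp [sub_eq_add_neg]
  · simp [azimuth]
  · rw [azimuth, azimuth, if_neg (by omega), if_pos (by omega)]
    simp [sub_eq_add_neg]

lemma base_mul_conj (n : S2) :
    ((n.1 0 : ℂ) + (n.1 1 : ℂ) * Complex.I) * ((n.1 0 : ℂ) - (n.1 1 : ℂ) * Complex.I) =
      1 - (n.1 2 : ℂ) ^ 2 := by
  have hn : ((n.1 0 : ℝ) : ℂ) ^ 2 + (n.1 1 : ℂ) ^ 2 + (n.1 2 : ℂ) ^ 2 = 1 := by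
    have := congrArg Complex.ofReal (sum_sq_coord n)
    push_cast at this
    exact this
  linear_combination hn - (n.1 1 : ℂ) ^ 2 * Complex.I_sq

lemma azimuth_mul_conj (m : ℤ) (n : S2) :
    azimuth m n * (starRingEnd ℂ) (azimuth m n) = (((1 - n.1 2 ^ 2) ^ m.natAbs : ℝ) : ℂ) := by
  push_cast
  rw [← base_mul_conj, mul_pow, ← azimuth_neg]
  rcases lt_trichotomy m 0 with h | rfl | h
  · rw [azimuth, azimuth, if_neg (by omega), if_pos (by omega), Int.natAbs_neg, mul_comm]
  · simp [azimuth]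
  · rw [azimuth, azimuth, if_pos (by omega), if_neg (by omega), Int.natAbs_neg]

lemma azimuth_rotZ (m : ℤ) (p : ℝ) (n : S2) :
    azimuth m (isoAct (rotZ p) n) = Complex.exp (m * p * Complex.I) * azimuth m n := by
  have h1 : ∀ k : ℕ, Complex.exp (k * p * Complex.I) =
      (Complex.cos p + Complex.sin p * Complex.I) ^ k := by
    intro k
    rw [← Complex.exp_mul_I, ← Complex.exp_nat_mul, mul_assoc]
  have h2 : ∀ k : ℕ, Complex.exp (-k * p * Complex.I) =
      (Complex.cos p - Complex.sin p * Complex.I) ^ k := by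
    intro k
    have h3 : Complex.cos p - Complex.sin p * Complex.I = Complex.exp (-p * Complex.I) := by
      rw [Complex.exp_mul_I, Complex.cos_neg, Complex.sin_neg]
      ring
    rw [h3, ← Complex.exp_nat_mul]
    ring_nf
  simp only [azimuth, isoAct_coe, rotZ_apply]
  split_ifs with h
  · lift m to ℕ using h
    simp only [Int.natAbs_natCast, Matrix.cons_val, Int.cast_natCast, h1, ← mul_pow]
    congr 1
    push_cast
    linear_combination (-(n.1 1 : ℂ) * Complex.sin p) * Complex.I_sq
  · obtain ⟨k, rfl⟩ : ∃ k : ℕ, m = -k := ⟨m.natAbs, by omega⟩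
    simp only [Int.natAbs_neg, Int.natAbs_natCast, Matrix.cons_val, Int.cast_neg, Int.cast_natCast,
      h2, ← mul_pow]
    congr 1
    push_cast
    linear_combination (-(n.1 1 : ℂ) * Complex.sin p) * Complex.I_sq

/-- This treats both signs of m at once. The sign s depends on m alone, so it cancels in products of
harmonics with equal m. -/
lemma sphHarm_eq (m : ℤ) : ∃ s : ℝ, s * s = 1 ∧ ∀ l n, sphHarm l m n =
    ((s * (normConst l m.natAbs * (derivative^[m.natAbs] (legendre l)).eval (n.1 2)) : ℝ) : ℂ) *
      azimuth m n := by
  by_cases h : 0 ≤ m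
  · refine ⟨(-1) ^ m.natAbs, by rw [← mul_pow]; simp, fun l n => ?_⟩
    rw [sphHarm, if_pos h, sphHarmNat, azimuth, if_pos h]
    congr 2
    ring
  · refine ⟨1, by simp, fun l n => ?_⟩
    rw [sphHarm, if_neg h, sphHarmNat, azimuth, if_neg h]
    have h1 : ((-1 : ℂ) ^ m.natAbs) * (-1) ^ m.natAbs = 1 := by rw [← mul_pow]; simp
    simp only [map_mul, Complex.conj_ofReal, map_pow, map_add, Complex.conj_I]
    push_cast
    rw [mul_neg, ← sub_eq_add_neg]
    linear_combination (normConst l m.natAbs * (((derivative^[m.natAbs] (legendre l)).eval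
      (n.1 2) : ℝ) : ℂ) * ((n.1 0 : ℂ) - (n.1 1 : ℂ) * Complex.I) ^ m.natAbs) * h1

@[fun_prop]
lemma continuous_sphHarm (l : ℕ) (m : ℤ) : Continuous (sphHarm l m) := by
  obtain ⟨s, -, hs⟩ := sphHarm_eq m
  have : sphHarm l m = fun n => _ := funext (hs l)
  rw [this]
  have := (derivative^[m.natAbs] (legendre l)).continuous
  fun_prop

lemma sphHarm_rotZ (l : ℕ) (m : ℤ) (p : ℝ) (n : S2) :
    sphHarm l m (isoAct (rotZ p) n) = Complex.exp (m * p * Complex.I) * sphHarm l m n := by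
  obtain ⟨s, -, hs⟩ := sphHarm_eq m
  rw [hs, hs, azimuth_rotZ, isoAct_coe, rotZ_apply]
  simp only [Matrix.cons_val]
  ring

/-- The spherical harmonics are orthonormal. -/
lemma integral_sphHarm_mul_conj {l l' : ℕ} {m m' : ℤ} (hm : |m| ≤ l) (hm' : |m'| ≤ l') :
    ∫ n, sphHarm l m n * (starRingEnd ℂ) (sphHarm l' m' n) ∂sphereMeasure =
      if l = l' ∧ m = m' then 1 else 0 := by
  rw [Int.abs_eq_natAbs] at hm hm'
  by_cases h : m = m'
  · subst h
    obtain ⟨s, hs1, hs⟩ := sphHarm_eq m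
    have h1 : ∀ n, sphHarm l m n * (starRingEnd ℂ) (sphHarm l' m n) =
        ((normConst l m.natAbs * normConst l' m.natAbs * ((1 - X ^ 2) ^ m.natAbs *
          (derivative^[m.natAbs] (legendre l) * derivative^[m.natAbs] (legendre l'))).eval
            (n.1 2) : ℝ) : ℂ) := by
      intro n
      rw [hs, hs, map_mul, Complex.conj_ofReal, mul_mul_mul_comm, azimuth_mul_conj,
        ← Complex.ofReal_mul, ← Complex.ofReal_mul]
      congr 1
      simp only [eval_mul, eval_pow, eval_sub, eval_one, eval_X]
      linear_combination (normConst l m.natAbs * normConst l' m.natAbs * ((1 - n.1 2 ^ 2) ^ m.natAbs *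
          ((derivative^[m.natAbs] (legendre l)).eval (n.1 2) *
            (derivative^[m.natAbs] (legendre l')).eval (n.1 2)))) * hs1
    simp only [h1, integral_complex_ofReal, integral_const_mul]
    rw [← zInt, normConst_mul_zInt l l' m.natAbs (by omega) (by omega)]
    simp only [and_true]
    split_ifs <;> simp
  · rw [if_neg (by tauto)]
    -- Rotation by π/(m - m') multiplies the integrand by e^{iπ} = -1, so the integral equals its
    -- own negative.
    have h1 := integral_isoAct (rotZ (Real.pi / (m - m')))
      (fun n => sphHarm l m n * (starRingEnd ℂ) (sphHarm l' m' n))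
      ((continuous_sphHarm l m).mul (Complex.continuous_conj.comp (continuous_sphHarm l' m')))
    have h2 : ∀ n, sphHarm l m (isoAct (rotZ (Real.pi / (m - m'))) n) *
        (starRingEnd ℂ) (sphHarm l' m' (isoAct (rotZ (Real.pi / (m - m'))) n)) =
        (-1) * (sphHarm l m n * (starRingEnd ℂ) (sphHarm l' m' n)) := by
      intro n
      have hne : (m - m' : ℂ) ≠ 0 := by
        rw [sub_ne_zero]; exact_mod_cast h
      rw [sphHarm_rotZ, sphHarm_rotZ, map_mul, mul_mul_mul_comm, ← Complex.exp_conj,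
        ← Complex.exp_add, ← Complex.exp_pi_mul_I]
      congr 2
      simp only [map_mul, Complex.conj_ofReal, Complex.conj_I, map_intCast]
      push_cast
      field_simp
      ring
    simp only [h2, integral_const_mul] at h1
    linear_combination (-1 / 2) * h1

/-! ### Completeness of the spherical harmonics -/

lemma degree_iterate_derivative_legendre (m k : ℕ) :
    (derivative^[m] (legendre (k + m))).degree = k := by
  have hd : (derivative^[k + m + m] ((X ^ 2 - 1 : ℝ[X]) ^ (k + m))).natDegree ≤ k := by
    refine (natDegree_iterate_derivative _ _).trans ?_
    rw [natDegree_sq_sub_one_pow]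
    omega
  rw [iterate_derivative_legendre, degree_C_mul (by positivity)]
  refine degree_eq_of_le_of_coeff_ne_zero (natDegree_le_iff_degree_le.1 hd) ?_
  rw [coeff_iterate_derivative, show k + (k + m + m) = 2 * (k + m) by ring, coeff_sq_sub_one_pow,
    nsmul_eq_mul, mul_one, Nat.cast_ne_zero]
  exact (Nat.descFactorial_pos.2 (by omega)).ne'

/-- The continuous functions orthogonal to all spherical harmonics are orthogonal to the products
of an azimuthal factor with a polynomial in the third coordinate. -/
lemma integral_mul_azimuth_eq_zero {D : S2 → ℂ} (hD : Continuous D)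
    (h : ∀ (l : ℕ) (m : ℤ), |m| ≤ l → ∫ n, D n * (starRingEnd ℂ) (sphHarm l m n) ∂sphereMeasure = 0)
    (m : ℤ) (p : ℝ[X]) :
    ∫ n, D n * (azimuth m n * (p.eval (n.1 2) : ℝ)) ∂sphereMeasure = 0 := by
  have hint : ∀ p : ℝ[X], Integrable (fun n => D n * (azimuth m n * (p.eval (n.1 2) : ℝ)))
      sphereMeasure := fun p => continuous_integrable (by
    have := p.continuous
    fun_prop)
  let T : ℝ[X] →ₗ[ℝ] ℂ :=
    { toFun := fun p => ∫ n, D n * (azimuth m n * (p.eval (n.1 2) : ℝ)) ∂sphereMeasure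
      map_add' := fun p q => by
        rw [← integral_add (hint p) (hint q)]
        refine integral_congr_ae (.of_forall fun n => ?_)
        simp only [eval_add, Complex.ofReal_add]
        ring_nf
      map_smul' := fun c p => by
        rw [RingHom.id_apply, Complex.real_smul, ← integral_const_mul]
        refine integral_congr_ae (.of_forall fun n => ?_)
        simp only [eval_smul, smul_eq_mul, Complex.ofReal_mul]
        ring }
  -- One polynomial of each exact degree: over a field these span all polynomials.
  let S : Polynomial.Sequence ℝ :=
    ⟨fun k => derivative^[m.natAbs] (legendre (k + m.natAbs)),
      degree_iterate_derivative_legendre m.natAbs⟩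
  have hS : Submodule.span ℝ (Set.range S) = ⊤ :=
    S.span fun i => (leadingCoeff_ne_zero.2 (S.ne_zero i)).isUnit
  have hT : T = 0 := by
    refine LinearMap.ext_on_range hS fun k => ?_
    change ∫ n, D n * (azimuth m n *
      ((derivative^[m.natAbs] (legendre (k + m.natAbs))).eval (n.1 2) : ℝ)) ∂sphereMeasure = 0
    -- The order is -m because the hypothesis conjugates the harmonic.
    have h1 := h (k + m.natAbs) (-m) (by rw [abs_neg, Int.abs_eq_natAbs]; omega)
    obtain ⟨s, hs1, hs⟩ := sphHarm_eq (-m)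
    have hN : normConst (k + m.natAbs) m.natAbs ≠ 0 := by
      rw [normConst]
      positivity
    have hc : ((s * normConst (k + m.natAbs) m.natAbs : ℝ) : ℂ) ≠ 0 := by
      rw [Complex.ofReal_ne_zero]
      exact mul_ne_zero (fun h0 => by simp [h0] at hs1) hN
    refine (mul_eq_zero_iff_left hc).1 ?_
    rw [← integral_const_mul, ← h1]
    refine integral_congr_ae (.of_forall fun n => ?_)
    simp only [hs, map_mul, Complex.conj_ofReal, ← azimuth_neg, neg_neg, Int.natAbs_neg]
    push_cast
    ring
  exact LinearMap.congr_fun hT p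

lemma azimuth_natCast (d : ℕ) (n : S2) :
    azimuth d n = ((n.1 0 : ℂ) + (n.1 1 : ℂ) * Complex.I) ^ d := by
  rw [azimuth, if_pos (Int.natCast_nonneg d), Int.natAbs_natCast]

lemma azimuth_neg_natCast (d : ℕ) (n : S2) :
    azimuth (-d) n = ((n.1 0 : ℂ) - (n.1 1 : ℂ) * Complex.I) ^ d := by
  rw [azimuth_neg, azimuth_natCast]
  simp [sub_eq_add_neg]

/-- A continuous function orthogonal to all spherical harmonics vanishes. -/
lemma eq_zero_of_orthogonal {D : S2 → ℂ} (hD : Continuous D)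
    (h : ∀ (l : ℕ) (m : ℤ), |m| ≤ l → ∫ n, D n * (starRingEnd ℂ) (sphHarm l m n) ∂sphereMeasure = 0) :
    D = 0 := by
  -- With u = x + iy, the relation u ū = 1 - z² absorbs the smaller of the two powers into the
  -- polynomial in z.
  have hmon : ∀ i j k : ℕ, ∫ n : S2, D n * (((n.1 0 : ℂ) + (n.1 1 : ℂ) * Complex.I) ^ i *
      ((n.1 0 : ℂ) - (n.1 1 : ℂ) * Complex.I) ^ j * (n.1 2 : ℂ) ^ k) ∂sphereMeasure = 0 := by
    intro i j k
    rcases le_total i j with hij | hij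
    · obtain ⟨d, rfl⟩ := Nat.exists_eq_add_of_le hij
      rw [← integral_mul_azimuth_eq_zero hD h (-d) ((1 - X ^ 2) ^ i * X ^ k)]
      refine integral_congr_ae (.of_forall fun n => ?_)
      simp only [azimuth_neg_natCast, eval_mul, eval_pow, eval_sub, eval_one, eval_X]
      push_cast
      rw [← base_mul_conj, mul_pow]
      ring
    · obtain ⟨d, rfl⟩ := Nat.exists_eq_add_of_le hij
      rw [← integral_mul_azimuth_eq_zero hD h d ((1 - X ^ 2) ^ j * X ^ k)]
      refine integral_congr_ae (.of_forall fun n => ?_)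
      simp only [azimuth_natCast, eval_mul, eval_pow, eval_sub, eval_one, eval_X]
      push_cast
      rw [← base_mul_conj, mul_pow]
      ring
  let u : C(S2, ℂ) := ⟨fun n => (n.1 0 : ℂ) + (n.1 1 : ℂ) * Complex.I, by fun_prop⟩
  let z : C(S2, ℂ) := ⟨fun n => (n.1 2 : ℂ), by fun_prop⟩
  let A : StarSubalgebra ℂ C(S2, ℂ) := StarAlgebra.adjoin ℂ {u, z}
  have hu : u ∈ A := StarAlgebra.subset_adjoin ℂ _ (by simp)
  have hz : z ∈ A := StarAlgebra.subset_adjoin ℂ _ (by simp)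
  have hsep : A.SeparatesPoints := by
    intro n n' hne
    by_contra! hcon
    have h1 := hcon u ⟨u, hu, rfl⟩
    have h2 := hcon z ⟨z, hz, rfl⟩
    refine hne (Subtype.ext (PiLp.ext fun k => ?_))
    have h3 := congrArg Complex.re h1
    have h4 := congrArg Complex.im h1
    have h5 := congrArg Complex.re h2
    simp [u] at h3 h4
    simp [z] at h5
    fin_cases k <;> assumption
  have hdense := ContinuousMap.starSubalgebra_topologicalClosure_eq_top_of_separatesPoints A hsep
  let J : C(S2, ℂ) →ₗ[ℂ] ℂ :=
    { toFun := fun f => ∫ n, D n * f n ∂sphereMeasure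
      map_add' := fun f g => by
        rw [← integral_add (continuous_integrable (by fun_prop)) (continuous_integrable (by fun_prop))]
        simp only [ContinuousMap.add_apply, mul_add]
      map_smul' := fun c f => by
        rw [RingHom.id_apply, smul_eq_mul, ← integral_const_mul]
        refine integral_congr_ae (.of_forall fun n => ?_)
        simp only [ContinuousMap.smul_apply, smul_eq_mul]
        ring }
  have hJc : Continuous J := by
    let Dc : C(S2, ℂ) := ⟨D, hD⟩
    refine AddMonoidHomClass.continuous_of_bound J (‖Dc‖ * sphereMeasure.real Set.univ) fun f => ?_
    have hb : ∀ n, ‖D n * f n‖ ≤ ‖Dc‖ * ‖f‖ := fun n => by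
      rw [norm_mul]
      exact mul_le_mul (Dc.norm_coe_le_norm n) (f.norm_coe_le_norm n) (norm_nonneg _)
        (norm_nonneg _)
    refine (norm_integral_le_of_norm_le_const (.of_forall hb)).trans_eq ?_
    ring
  have hJA : ∀ f ∈ A, J f = 0 := by
    have hle : Subalgebra.toSubmodule A.toSubalgebra ≤ LinearMap.ker J := by
      rw [StarAlgebra.adjoin_eq_span, Submodule.span_le]
      intro f hf
      obtain ⟨i, j, k, rfl⟩ : ∃ i j k : ℕ, f = u ^ i * star u ^ j * z ^ k := by
        induction hf using Submonoid.closure_induction with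
        | mem x hx =>
          have hsz : star z = z := by ext n; simp [z]
          rcases hx with (rfl | rfl) | hx
          · exact ⟨1, 0, 0, by simp⟩
          · exact ⟨0, 0, 1, by simp⟩
          · rcases Set.mem_star.1 hx with hx | hx
            · exact ⟨0, 1, 0, by simp [← hx]⟩
            · exact ⟨0, 0, 1, by rw [← star_star x, hx, hsz]; simp⟩
        | one => exact ⟨0, 0, 0, by simp⟩
        | mul x y _ _ hx hy =>
          obtain ⟨i, j, k, rfl⟩ := hx
          obtain ⟨i', j', k', rfl⟩ := hy
          exact ⟨i + i', j + j', k + k', by ring⟩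
      change ∫ n, D n * (u ^ i * star u ^ j * z ^ k) n ∂sphereMeasure = 0
      rw [← hmon i j k]
      refine integral_congr_ae (.of_forall fun n => ?_)
      simp [u, z, sub_eq_add_neg]
    exact fun f hf => hle hf
  have hJ : ∀ f, J f = 0 := by
    intro f
    have hf : f ∈ A.topologicalClosure := by rw [hdense]; trivial
    exact closure_minimal (s := (A : Set C(S2, ℂ))) (t := {f | J f = 0}) hJA
      (isClosed_singleton.preimage hJc) hf
  -- Testing against the conjugate of D gives ∫ |D|² = 0; continuity upgrades almost everywhere to
  -- everywhere.
  have hzero := hJ ⟨fun n => (starRingEnd ℂ) (D n), Complex.continuous_conj.comp hD⟩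
  change ∫ n, D n * (starRingEnd ℂ) (D n) ∂sphereMeasure = 0 at hzero
  simp only [Complex.mul_conj, integral_complex_ofReal, Complex.ofReal_eq_zero] at hzero
  have hcn : Continuous fun n => Complex.normSq (D n) := Complex.continuous_normSq.comp hD
  rw [integral_eq_zero_iff_of_nonneg (fun n => Complex.normSq_nonneg _)
    (continuous_integrable hcn)] at hzero
  have := (hcn.ae_eq_iff_eq sphereMeasure continuous_const).1 hzero
  funext n
  exact Complex.normSq_eq_zero.1 (congrFun this n)

lemma coeff_def (F : S2 → ℝ) (l : ℕ) (m : ℤ) :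
    coeff F l m = ∫ n, (F n : ℂ) * (starRingEnd ℂ) (sphHarm l m n) ∂sphereMeasure := rfl

/-- A continuous function whose coefficients vanish outside a finite set of degrees is the sum of
its expansion. -/
lemma eq_sum_of_coeff_eq_zero {F : S2 → ℝ} (hF : Continuous F) (s : Finset ℕ)
    (h : ∀ (l : ℕ) (m : ℤ), l ∉ s → |m| ≤ l → coeff F l m = 0) (n : S2) :
    (F n : ℂ) = ∑ l ∈ s, ∑ m ∈ Finset.Icc (-(l : ℤ)) l, coeff F l m * sphHarm l m n := by
  set D : S2 → ℂ := fun n => (F n : ℂ) -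
    ∑ l ∈ s, ∑ m ∈ Finset.Icc (-(l : ℤ)) l, coeff F l m * sphHarm l m n with hDdef
  have hD : Continuous D := by
    refine (Complex.continuous_ofReal.comp hF).sub ?_
    exact continuous_finsetSum _ fun l _ => continuous_finsetSum _ fun m _ =>
      continuous_const.mul (continuous_sphHarm l m)
  have hcj : ∀ (l : ℕ) (m : ℤ), Continuous fun n => (starRingEnd ℂ) (sphHarm l m n) := fun l m =>
    Complex.continuous_conj.comp (continuous_sphHarm l m)
  suffices D = 0 from sub_eq_zero.1 (congrFun this n)
  refine eq_zero_of_orthogonal hD fun l' m' hm' => ?_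
  have hterm : ∀ (l : ℕ) (m : ℤ), Integrable (fun n => coeff F l m * (sphHarm l m n *
      (starRingEnd ℂ) (sphHarm l' m' n))) sphereMeasure := fun l m =>
    continuous_integrable (continuous_const.mul ((continuous_sphHarm l m).mul (hcj l' m')))
  have h1 : ∫ n, D n * (starRingEnd ℂ) (sphHarm l' m' n) ∂sphereMeasure = coeff F l' m' -
      ∑ l ∈ s, ∑ m ∈ Finset.Icc (-(l : ℤ)) l, coeff F l m * (if l = l' ∧ m = m' then 1 else 0) := by
    simp only [hDdef, sub_mul, Finset.sum_mul, mul_assoc]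
    have hFi : Integrable (fun n => (F n : ℂ) * (starRingEnd ℂ) (sphHarm l' m' n)) sphereMeasure :=
      continuous_integrable ((Complex.continuous_ofReal.comp hF).mul (hcj l' m'))
    rw [integral_sub hFi (integrable_finsetSum _ fun l _ => integrable_finsetSum _ fun m _ => hterm l m), ← coeff_def,
      integral_finsetSum _ fun l _ => integrable_finsetSum _ fun m _ => hterm l m]
    congr 1
    refine Finset.sum_congr rfl fun l _ => ?_
    rw [integral_finsetSum _ fun m _ => hterm l m]
    refine Finset.sum_congr rfl fun m hm => ?_
    rw [integral_const_mul, integral_sphHarm_mul_conj (abs_le.2 (Finset.mem_Icc.1 hm)) hm']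
  rw [h1, sub_eq_zero]
  by_cases hl : l' ∈ s
  · rw [Finset.sum_eq_single l' (fun l _ hne => Finset.sum_eq_zero fun m _ => by simp [hne])
      (fun hn => absurd hl hn), Finset.sum_eq_single m' (fun m _ hne => by simp [hne])
      (fun hn => absurd (Finset.mem_Icc.2 (abs_le.1 hm')) hn)]
    simp
  · rw [h l' m' hl hm', Finset.sum_eq_zero]
    intro l hls
    refine Finset.sum_eq_zero fun m _ => ?_
    rw [if_neg (by rintro ⟨rfl, -⟩; exact hl hls), mul_zero]

/-! ### Characterisation of the continuous frame functions -/

lemma tetrahedral_sum_sphHarm {l : ℕ} (hl : l = 1 ∨ l = 2 ∨ l = 5) {m : ℤ} (hm : |m| ≤ l)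
    {n : Fin 4 → S2} (hn : IsTetrahedron n) : ∑ j, sphHarm l m (n j) = 0 := by
  rw [Int.abs_eq_natAbs] at hm
  obtain ⟨N, c, a₁, a₂, ha, h⟩ := exists_sphHarmNat_eq_sum l m.natAbs (by omega)
  have h0 : ∑ j, sphHarmNat l m.natAbs (n j) = 0 := by
    simp only [h]
    rw [Finset.sum_comm]
    simp only [← Finset.mul_sum, tetrahedral_sum_cdot_pow hl (ha _) hn, mul_zero,
      Finset.sum_const_zero]
  simp only [sphHarm]
  split_ifs
  · exact h0
  · rw [← Finset.mul_sum, ← map_sum, h0, map_zero, mul_zero]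

lemma IsIsotropic.neg_right {a₁ a₂ : E3} (h : IsIsotropic a₁ a₂) : IsIsotropic a₁ (-a₂) :=
  ⟨by simpa using h.1, by simpa using h.2⟩

lemma conj_cdot (a₁ a₂ n : E3) : (starRingEnd ℂ) (cdot a₁ a₂ n) = cdot a₁ (-a₂) n := by
  simp [cdot]

/-- The harmonics of a continuous function with tetrahedral sums `1`. -/
lemma coeff_eq_zero_of_tetrahedral_sum {F : S2 → ℝ} (hF : Continuous F)
    (hsum : ∀ n, IsTetrahedron n → ∑ j, F (n j) = 1) {l : ℕ} {m : ℤ}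
    (hl : l ∉ ({0, 1, 2, 5} : Finset ℕ)) (hm : |m| ≤ l) : coeff F l m = 0 := by
  simp only [Finset.mem_insert, Finset.mem_singleton, not_or] at hl
  obtain ⟨h0, h1, h2, h5⟩ := hl
  rw [Int.abs_eq_natAbs] at hm
  have hFc : Continuous fun n => (F n : ℂ) := Complex.continuous_ofReal.comp hF
  have hsumc : ∀ n, IsTetrahedron n → ∑ j, (F (n j) : ℂ) = 1 := fun n hn => by
    rw [← Complex.ofReal_sum, hsum n hn, Complex.ofReal_one]
  obtain ⟨N, c, a₁, a₂, ha, h⟩ := exists_sphHarmNat_eq_sum l m.natAbs (by omega)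
  -- The coefficients and imaginary parts are left free because for m ≥ 0 the conjugated harmonic
  -- has conjugate coefficients and vectors a₁ - i a₂.
  have key : ∀ (c : ℕ → ℂ) (a₂ : ℕ → E3), (∀ i, IsIsotropic (a₁ i) (a₂ i)) →
      ∫ n : S2, (F n : ℂ) * ∑ i ∈ Finset.range N, c i * cdot (a₁ i) (a₂ i) n ^ l
        ∂sphereMeasure = 0 := by
    intro c a₂ ha
    simp only [Finset.mul_sum]
    rw [integral_finsetSum _ fun i _ => continuous_integrable (by fun_prop)]
    refine Finset.sum_eq_zero fun i _ => ?_
    have := integral_mul_cdot_pow_eq_zero hFc hsumc h0 h1 h2 h5 (ha i)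
    simp only [mul_left_comm _ (c i), integral_const_mul, this, mul_zero]
  rw [coeff_def]
  by_cases hm0 : 0 ≤ m
  · rw [← key (fun i => (starRingEnd ℂ) (c i)) (fun i => -a₂ i) fun i => (ha i).neg_right]
    refine integral_congr_ae (.of_forall fun n => ?_)
    simp only [sphHarm, if_pos hm0, h, map_sum, map_mul, map_pow, conj_cdot]
  · rw [← mul_zero ((-1) ^ m.natAbs), ← key c a₂ ha, ← integral_const_mul]
    refine integral_congr_ae (.of_forall fun n => ?_)
    simp only [sphHarm, if_neg hm0, map_mul, map_pow, map_neg, map_one, Complex.conj_conj, h]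
    ring

lemma sphHarm_zero_right (l : ℕ) (n : S2) :
    sphHarm l 0 n = ((normConst l 0 * (legendre l).eval (n.1 2) : ℝ) : ℂ) := by
  simp [sphHarm, sphHarmNat]

lemma normConst_zero_zero : normConst 0 0 = (Real.sqrt (4 * Real.pi))⁻¹ := by
  simp [normConst]

lemma legendre_zero : legendre 0 = 1 := by simp [legendre]

lemma sphHarm_zero_zero (n : S2) : sphHarm 0 0 n = ((Real.sqrt (4 * Real.pi))⁻¹ : ℝ) := by
  rw [sphHarm_zero_right, legendre_zero, eval_one, mul_one, normConst_zero_zero]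

lemma coeff_zero_zero_of_tetrahedral_sum {F : S2 → ℝ} (hF : Continuous F)
    (hsum : ∀ n, IsTetrahedron n → ∑ j, F (n j) = 1) :
    coeff F 0 0 = (Real.sqrt (4 * Real.pi) / 4 : ℝ) := by
  have h := integral_of_tetrahedral_sum (Complex.continuous_ofReal.comp hF) fun n hn => by
    simp only [Function.comp_apply]
    rw [← Complex.ofReal_sum, hsum n hn, Complex.ofReal_one]
  simp only [Function.comp_apply] at h
  simp only [coeff_def, sphHarm_zero_zero, Complex.conj_ofReal, integral_mul_const, h]
  rw [← Complex.ofReal_mul]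
  congr 1
  have h1 : Real.sqrt (4 * Real.pi) ≠ 0 := by positivity
  have h2 : Real.sqrt (4 * Real.pi) ^ 2 = 4 * Real.pi := Real.sq_sqrt (by positivity)
  rw [← div_eq_mul_inv, div_eq_div_iff h1 four_ne_zero, ← sq, h2, mul_comm]

/-- The bound by 1 comes for free: every direction belongs to a tetrahedron, over which nonnegative
values sum to 1. -/
lemma isFrameFunction_of_sum {f : Effect → ℝ} (h0 : ∀ n, 0 ≤ onSphere f n)
    (hsum : ∀ n, IsTetrahedron n → ∑ j, onSphere f (n j) = 1) : IsFrameFunction f := by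
  refine ⟨?_, hsum⟩
  rintro ⟨_, n, rfl⟩
  refine ⟨h0 n, ?_⟩
  obtain ⟨v, hv, rfl⟩ := exists_tetrahedron n
  change onSphere f (v 0) ≤ 1
  rw [← hsum v hv]
  exact Finset.single_le_sum (f := fun j => onSphere f (v j)) (fun j _ => h0 _) (Finset.mem_univ 0)

/-- The description of the continuous frame functions. -/
lemma isFrameFunction_iff {f : Effect → ℝ} (hf : Continuous (onSphere f)) :
    IsFrameFunction f ↔ (∀ n, 0 ≤ onSphere f n) ∧
      coeff (onSphere f) 0 0 = (Real.sqrt (4 * Real.pi) / 4 : ℝ) ∧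
      ∀ n, (onSphere f n : ℂ) = ∑ l ∈ ({0, 1, 2, 5} : Finset ℕ), ∑ m ∈ Finset.Icc (-(l : ℤ)) l,
        coeff (onSphere f) l m * sphHarm l m n := by
  constructor
  · intro h
    exact ⟨fun n => (h.mem_unit _).1, coeff_zero_zero_of_tetrahedral_sum hf h.sum_eq_one,
      eq_sum_of_coeff_eq_zero hf _ fun l m hl hm =>
        coeff_eq_zero_of_tetrahedral_sum hf h.sum_eq_one hl hm⟩
  · rintro ⟨h0, hc, hexp⟩
    refine isFrameFunction_of_sum h0 fun n hn => ?_
    have h1 : ∑ j, (onSphere f (n j) : ℂ) = 1 := by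
      simp only [hexp]
      rw [Finset.sum_comm, Finset.sum_eq_single 0]
      · rw [Finset.sum_comm]
        simp only [Nat.cast_zero, neg_zero, Finset.Icc_self, Finset.sum_singleton, hc,
          sphHarm_zero_zero]
        rw [Finset.sum_const, Finset.card_univ, Fintype.card_fin, ← Complex.ofReal_mul,
          nsmul_eq_mul]
        have h1 : Real.sqrt (4 * Real.pi) ≠ 0 := by positivity
        rw [div_mul_eq_mul_div, mul_inv_cancel₀ h1]
        norm_num
      · intro l hl hl0
        rw [Finset.sum_comm]
        refine Finset.sum_eq_zero fun m hm => ?_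
        rw [← Finset.mul_sum, tetrahedral_sum_sphHarm (by simp at hl; tauto)
          (abs_le.2 (Finset.mem_Icc.1 hm)) hn, mul_zero]
      · simp
    exact_mod_cast h1

/-! ### Zonal frame functions and failure of the quantum rule -/

lemma legendre_one : legendre 1 = X := by
  refine funext fun x => ?_
  simp [legendre]
  ring

lemma legendre_two : legendre 2 = C (3 / 2) * X ^ 2 - C (1 / 2) := by
  have h : ((X ^ 2 - 1) ^ 2 : ℝ[X]) = X ^ 4 - 2 • X ^ 2 + C 1 := by
    simp only [C_1]
    ring
  rw [legendre, h, iterate_map_add, iterate_derivative_sub, iterate_derivative_smul,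
    iterate_derivative_C two_pos]
  simp only [iterate_derivative_X_pow_eq_natCast_mul]
  refine funext fun x => ?_
  simp [Nat.descFactorial, Nat.factorial]
  ring

lemma legendre_five : legendre 5 = C (63 / 8) * X ^ 5 - C (35 / 4) * X ^ 3 + C (15 / 8) * X := by
  have h : ((X ^ 2 - 1) ^ 5 : ℝ[X]) =
      X ^ 10 - 5 • X ^ 8 + 10 • X ^ 6 - 10 • X ^ 4 + 5 • X ^ 2 - C 1 := by
    simp only [C_1]
    ring
  rw [legendre, h]
  simp only [iterate_map_add, iterate_derivative_sub, iterate_derivative_smul,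
    iterate_derivative_C (show 0 < 5 by norm_num), iterate_derivative_X_pow_eq_natCast_mul]
  refine funext fun x => ?_
  simp [Nat.descFactorial, Nat.factorial]
  ring

/-- A function on the effects which contains the harmonics `0` and `l`. -/
def zonalFun (l : ℕ) (E : Effect) : ℝ :=
  1 / 4 + 1 / 100 * (legendre l).eval (4 * ((E : QubitOp) 0 0).re - 1)

lemma onSphere_zonalFun (l : ℕ) (n : S2) :
    onSphere (zonalFun l) n = 1 / 4 + 1 / 100 * (legendre l).eval (n.1 2) := by
  have : 4 * ((effect n : QubitOp) 0 0).re - 1 = n.1 2 := by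
    simp [effect, blochOp, pauliX, pauliY, pauliZ]
    ring
  rw [onSphere, zonalFun, this]

lemma continuous_zonalFun (l : ℕ) : Continuous (onSphere (zonalFun l)) := by
  have := (legendre l).continuous
  simp only [funext (onSphere_zonalFun l)]
  fun_prop

lemma abs_coord_le (n : S2) (k : Fin 3) : |n.1 k| ≤ 1 := by
  exact (PiLp.norm_apply_le n.1 k).trans_eq (norm_eq_of_mem_sphere n)

/-- A crude bound from the absolute values of the coefficients (63/8 + 35/4 + 15/8 < 25). The value
25 is what the weight 1/100 tolerates next to 1/4. -/
lemma abs_legendre_le {l : ℕ} (hl : l = 1 ∨ l = 2 ∨ l = 5) {x : ℝ} (hx : |x| ≤ 1) :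
    |(legendre l).eval x| ≤ 25 := by
  have hp : ∀ k, |x| ^ k ≤ 1 := fun k => pow_le_one₀ (abs_nonneg x) hx
  have hq : ∀ k, -1 ≤ x ^ k ∧ x ^ k ≤ 1 := fun k => abs_le.1 (by rw [abs_pow]; exact hp k)
  have h1 := hq 1
  have h2 := hq 2
  have h3 := hq 3
  have h5 := hq 5
  rw [abs_le]
  rcases hl with rfl | rfl | rfl
  · rw [legendre_one]
    simp only [eval_X]
    constructor <;> linarith [h1.1, h1.2]
  · rw [legendre_two]
    simp only [eval_sub, eval_mul, eval_C, eval_pow, eval_X]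
    constructor <;> linarith [h2.1, h2.2]
  · rw [legendre_five]
    simp only [eval_sub, eval_add, eval_mul, eval_C, eval_pow, eval_X]
    constructor <;> linarith [h1.1, h1.2, h3.1, h3.2, h5.1, h5.2]

lemma normConst_pos (l : ℕ) : 0 < normConst l 0 := by
  rw [normConst]
  positivity

lemma isFrameFunction_zonalFun {l : ℕ} (hl : l = 1 ∨ l = 2 ∨ l = 5) :
    IsFrameFunction (zonalFun l) := by
  refine isFrameFunction_of_sum (fun n => ?_) fun n hn => ?_
  · rw [onSphere_zonalFun]
    linarith [(abs_le.1 (abs_legendre_le hl (abs_coord_le n 2))).1]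
  · have h := tetrahedral_sum_sphHarm hl (m := 0) (by simp) hn
    simp only [sphHarm_zero_right, ← Complex.ofReal_sum, ← Finset.mul_sum] at h
    have h1 : ∑ j, (legendre l).eval ((n j).1 2) = 0 := by
      have h2 := Complex.ofReal_eq_zero.1 h
      exact (mul_eq_zero.1 h2).resolve_left (normConst_pos l).ne'
    simp only [onSphere_zonalFun, Finset.sum_add_distrib, ← Finset.mul_sum, h1]
    simp

lemma coeff_zonalFun (l : ℕ) {k : ℕ} {m : ℤ} (hm : |m| ≤ k) :
    coeff (onSphere (zonalFun l)) k m =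
      ((1 / 4 * Real.sqrt (4 * Real.pi) : ℝ) : ℂ) * (if 0 = k ∧ 0 = m then 1 else 0) +
      ((1 / 100 * (normConst l 0)⁻¹ : ℝ) : ℂ) * (if l = k ∧ 0 = m then 1 else 0) := by
  have hcj : Continuous fun n => (starRingEnd ℂ) (sphHarm k m n) :=
    Complex.continuous_conj.comp (continuous_sphHarm k m)
  rw [← integral_sphHarm_mul_conj (l := 0) (m := 0) (by simp) hm,
    ← integral_sphHarm_mul_conj (l := l) (m := 0) (by simp) hm, ← integral_const_mul,
    ← integral_const_mul, ← integral_add (continuous_integrable (by fun_prop))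
    (continuous_integrable (by fun_prop)), coeff_def]
  refine integral_congr_ae (.of_forall fun n => ?_)
  have h1 : Real.sqrt (4 * Real.pi) ≠ 0 := by positivity
  have h2 := (normConst_pos l).ne'
  have : (onSphere (zonalFun l) n : ℂ) =
      ((1 / 4 * Real.sqrt (4 * Real.pi) : ℝ) : ℂ) * sphHarm 0 0 n +
      ((1 / 100 * (normConst l 0)⁻¹ : ℝ) : ℂ) * sphHarm l 0 n := by
    rw [sphHarm_zero_zero, sphHarm_zero_right, onSphere_zonalFun, ← Complex.ofReal_mul,
      ← Complex.ofReal_mul, ← Complex.ofReal_add]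
    congr 1
    field_simp
  simp only [this]
  ring

lemma hasHarmonic_zonalFun {l : ℕ} (hl : l ≠ 0) (k : ℕ) :
    HasHarmonic (onSphere (zonalFun l)) k ↔ k = 0 ∨ k = l := by
  have h1 : ((1 / 4 * Real.sqrt (4 * Real.pi) : ℝ) : ℂ) ≠ 0 := by
    rw [Complex.ofReal_ne_zero]; positivity
  have h2 : ((1 / 100 * (normConst l 0)⁻¹ : ℝ) : ℂ) ≠ 0 := by
    rw [Complex.ofReal_ne_zero]
    have := normConst_pos l
    positivity
  constructor
  · rintro ⟨m, hm, hne⟩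
    by_contra! h
    rw [coeff_zonalFun l hm, if_neg (by tauto), if_neg (by tauto)] at hne
    simp at hne
  · intro h
    refine ⟨0, by simp, ?_⟩
    rw [coeff_zonalFun l (by simp)]
    rcases h with rfl | rfl
    · rw [if_pos ⟨rfl, rfl⟩, if_neg (by tauto), mul_zero, add_zero, mul_one]
      exact h1
    · rw [if_neg (by tauto), if_pos ⟨rfl, rfl⟩, mul_zero, zero_add, mul_one]
      exact h2

/-- A trace rule is affine in n. Its mean over (±4/5, 0, 3/5) would be 4/5 of its value at the north
pole plus 1/5 of that at the south pole, and P_2 and P_5 violate this. -/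
lemma not_isQuantum_zonalFun {l : ℕ} (hl : l = 2 ∨ l = 5) : ¬ IsQuantum (zonalFun l) := by
  rintro ⟨W, -, hW⟩
  obtain ⟨a, b, c, d, h⟩ : ∃ a b c d : ℝ, ∀ n : S2,
      onSphere (zonalFun l) n = a + b * n.1 0 + c * n.1 1 + d * n.1 2 := by
    refine ⟨((W 0 0).re + (W 1 1).re) / 4, ((W 0 1).re + (W 1 0).re) / 4,
      ((W 1 0).im - (W 0 1).im) / 4, ((W 0 0).re - (W 1 1).re) / 4, fun n => ?_⟩
    have := congrArg Complex.re (hW (effect n))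
    rw [Complex.ofReal_re] at this
    rw [onSphere, this]
    simp [effect, blochOp, pauliX, pauliY, pauliZ, Matrix.trace_fin_two, Matrix.mul_apply,
      Fin.sum_univ_two]
    ring
  simp only [onSphere_zonalFun] at h
  have h1 := h ⟨!₂[4 / 5, 0, 3 / 5], by
    simp [EuclideanSpace.norm_eq, Fin.sum_univ_three]; norm_num⟩
  have h2 := h ⟨!₂[-4 / 5, 0, 3 / 5], by
    simp [EuclideanSpace.norm_eq, Fin.sum_univ_three]; norm_num⟩
  have h3 := h northPole
  have h4 := h ⟨!₂[0, 0, -1], by simp [EuclideanSpace.norm_eq, Fin.sum_univ_three]⟩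
  simp only [northPole, Matrix.cons_val] at h1 h2 h3 h4
  rcases hl with rfl | rfl
  · rw [legendre_two] at h1 h2 h3 h4
    norm_num at h1 h2 h3 h4
    linarith
  · rw [legendre_five] at h1 h2 h3 h4
    norm_num at h1 h2 h3 h4
    linarith

/-- With one vertex at the pole the other three have z = -1/3, so this value says 1 + 3 P_5(-1/3) =
0. By the threefold symmetry the only other orders to check are m = ±3, where P_5^3(-1/3) = 0 is the
condition. -/
lemma legendre_five_eval : (legendre 5).eval (-1 / 3) = -1 / 3 := by
  rw [legendre_five]
  norm_num

lemma assocLegendre_five_three : assocLegendre 5 3 (-1 / 3) = 0 := by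
  have : (derivative^[3] (legendre 5)).eval (-1 / 3 : ℝ) = 0 := by
    rw [legendre_five]
    simp only [iterate_map_add, iterate_derivative_sub, iterate_derivative_C_mul,
      iterate_derivative_X_pow_eq_natCast_mul, iterate_derivative_X (show 1 < 3 by norm_num)]
    norm_num [Nat.descFactorial]
  rw [assocLegendre, this, mul_zero]

lemma allowed_iff (l : ℕ) : Allowed l ↔ l ∈ ({0, 1, 2, 5} : Set ℕ) := by
  constructor
  · rintro ⟨f, hf, hc, m, hm, hne⟩
    by_contra hl
    exact hne (coeff_eq_zero_of_tetrahedral_sum hc hf.sum_eq_one (by simpa using hl) hm)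
  · rintro (rfl | h)
    · exact ⟨zonalFun 1, isFrameFunction_zonalFun (by simp), continuous_zonalFun 1,
        (hasHarmonic_zonalFun one_ne_zero 0).2 (Or.inl rfl)⟩
    · have hl : l = 1 ∨ l = 2 ∨ l = 5 := by simpa using h
      exact ⟨zonalFun l, isFrameFunction_zonalFun hl, continuous_zonalFun l,
        (hasHarmonic_zonalFun (by omega) l).2 (Or.inr rfl)⟩

end Tetrahedral

end

theorem mainTheorem5 :
    -- the allowed harmonics are exactly `l = 0, 1, 2, 5`
    {l : ℕ | Tetrahedral.Allowed l} = {0, 1, 2, 5} ∧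
    -- description of all frame functions that are continuous on the sphere
    (∀ f : Tetrahedral.Effect → ℝ, Continuous (Tetrahedral.onSphere f) →
      (Tetrahedral.IsFrameFunction f ↔
        (∀ n, 0 ≤ Tetrahedral.onSphere f n) ∧
        Tetrahedral.coeff (Tetrahedral.onSphere f) 0 0 = (Real.sqrt (4 * Real.pi) / 4 : ℝ) ∧
        ∀ n, (Tetrahedral.onSphere f n : ℂ) =
          ∑ l ∈ ({0, 1, 2, 5} : Finset ℕ), ∑ m ∈ Finset.Icc (-(l : ℤ)) l,
            Tetrahedral.coeff (Tetrahedral.onSphere f) l m * Tetrahedral.sphHarm l m n)) ∧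
    -- `l = 2` and `l = 5` occur, each without any other harmonic but `l = 0`, and the quantum rule
    -- then fails
    (∀ l : ℕ, l = 2 ∨ l = 5 →
      ∃ f, Tetrahedral.IsFrameFunction f ∧ Continuous (Tetrahedral.onSphere f) ∧
        (∀ k, Tetrahedral.HasHarmonic (Tetrahedral.onSphere f) k ↔ k = 0 ∨ k = l) ∧
        ¬ Tetrahedral.IsQuantum f) ∧
    -- the sum over the vertices of a tetrahedron with a vertex on the `x` axis
    (∀ α : ℝ,
      Complex.exp (α * Complex.I) =
        ((-1 / Real.sqrt 7 : ℝ) : ℂ) + (Real.sqrt (6 / 7) : ℂ) * Complex.I →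
      ∀ l : ℕ, 1 + ((-1) ^ l + 2 * Real.sqrt 7 ^ l * Real.cos (l * α)) / 3 ^ l = 0 ↔
        l = 1 ∨ l = 2 ∨ l = 5) ∧
    -- the values of Legendre functions that govern `l = 5`
    (Tetrahedral.legendre 5).eval (-1 / 3) = -1 / 3 ∧
    Tetrahedral.assocLegendre 5 3 (-1 / 3) = 0 := by
  refine ⟨Set.ext Tetrahedral.allowed_iff, fun f hf => Tetrahedral.isFrameFunction_iff hf,
    fun l hl => ⟨Tetrahedral.zonalFun l, Tetrahedral.isFrameFunction_zonalFun (Or.inr hl),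
      Tetrahedral.continuous_zonalFun l, Tetrahedral.hasHarmonic_zonalFun (by omega),
      Tetrahedral.not_isQuantum_zonalFun hl⟩,
    Tetrahedral.vertex_sum_angle, Tetrahedral.legendre_five_eval,
    Tetrahedral.assocLegendre_five_three⟩
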